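/- A quantum query algorithm with access to a unitary $U$ acts on the register of $U$ together with finitely many ancilla qubits. It starts in a fixed computational basis state and is a finite adaptive program made of arbitrary $U$-independent unitaries, computational-basis measurements, and queries (one application of $U$, $U^\dagger$, controlled-$U$ or controlled-$U^\dagger$). It finally outputs a string in $\{0,1\}^n$. Its number of queries is the maximum over all measurement outcomes. **Theorem.** There are constants $\varepsilon>0$, $C>0$ and $n_0$ such that for all $n\ge n_0$ there is, in each of the following three settings, a quantum query algorithm that makes at most $C\cdot 2^{n/3}$ queries and whose output $z$ satisfies $$\mathbb{E}\big[|\langle z|\psi\rangle|^2\big]\ \ge\ \frac{2+\varepsilon}{2^n},$$ that is, the algorithm solves $(2+\Omega(1))$-XHOG. Here $|\psi\rangle$ is a Haar-random $n$-qubit state, and the expectation is over $|\psi\rangle$, any further randomness of the oracle, and the algorithm's own randomness (its measurement outcomes). 1. *Arbitrary state preparation oracle.* For every finite-dimensional garbage register with a fixed basis state $|g_0\rangle$, one and the same algorithm (for given $n$ and register) works for every random unitary $U$, drawn jointly with $|\psi\rangle$ from any probability distribution, such that almost surely $U|0^n\rangle|g_0\rangle=|\psi\rangle|\varphi\rangle$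 for some state $|\varphi\rangle$ of the garbage register, which may depend on $U$ and $|\psi\rangle$. The register may be trivial (no garbage). 2. *Canonical state preparation oracle.* The oracle is $\mathcal O_\psi$, the reflection $\mathbb{1}-2|\chi\rangle\langle\chi|$ about $|\chi\rangle=\frac{|\psi\rangle|1\rangle-|\bot\rangle}{\sqrt2}$ on $n+1$ qubits, where $|\bot\rangle=|0^n\rangle|0\rangle$ and an $n$-qubit state $|\psi\rangle$ is encoded as $|\psi\rangle|1\rangle$. 3. *Haar-random unitary.* The oracle $U$ is a Haar-random $n$-qubit unitary and $|\psi\rangle=U|0^n\rangle$. -/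

import Mathlib

namespace XHOG

open MeasureTheory Matrix

/-- Bit strings of length `n`, which index the computational basis of `n` qubits. -/
abbrev Bits (n : ℕ) : Type := Fin n → Bool

/-- The all-zeros string. -/
def zeros (n : ℕ) : Bits n := fun _ => false

/-- Pure `n`-qubit states: unit vectors of `ℂ^(2^n)`. -/
abbrev State (n : ℕ) : Type := Metric.sphere (0 : EuclideanSpace ℂ (Bits n)) 1

/-- The law of a Haar-random `n`-qubit state: the uniform probability measure on the unit sphere
(surface measure induced by a translation invariant measure on `ℂ^(2^n)`, normalized). -/
noncomputable def haarState (n : ℕ) : Measure (State n) :=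
  ((Measure.addHaar : Measure (EuclideanSpace ℂ (Bits n))).toSphere Set.univ)⁻¹ •
    (Measure.addHaar : Measure (EuclideanSpace ℂ (Bits n))).toSphere

/-- The Borel `σ`-algebra on the group of unitary matrices. -/
noncomputable instance {ι : Type} [Fintype ι] [DecidableEq ι] : MeasurableSpace (unitaryGroup ι ℂ) :=
  borel _

instance {ι : Type} [Fintype ι] [DecidableEq ι] : BorelSpace (unitaryGroup ι ℂ) :=
  ⟨rfl⟩

/-- A quantum query algorithm with output in `{0,1}^n`. The oracle is a unitary on the oracle
register `ℂ^B`; in addition there are `a` ancilla qubits. The algorithm is a finite adaptive program: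
* `output z`: halt and output `z`;
* `gate V next`: apply a unitary `V`, independent of the oracle, to all registers;
* `query adj ctrl next`: one query, that is, apply the oracle `U` (or `U†` if `adj = true`) to the
  oracle register, controlled on an ancilla qubit if `ctrl = some c`;
* `measure f next`: measure the value of the function `f` of the computational basis state, and
  continue with the program `next r` on outcome `r` (outcomes are labelled by basis states, and
  `f = id` is the complete measurement in the computational basis). -/
inductive QueryAlgorithm (n : ℕ) (B : Type) [Fintype B] [DecidableEq B] (a : ℕ) : Type
  | output (z : Bits n) : QueryAlgorithm n B a
  | gate (V : unitaryGroup (B × Bits a) ℂ) (next : QueryAlgorithm n B a) : QueryAlgorithm n B a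
  | query (adj : Bool) (ctrl : Option (Fin a)) (next : QueryAlgorithm n B a) :
      QueryAlgorithm n B a
  | measure (f : B × Bits a → B × Bits a) (next : B × Bits a → QueryAlgorithm n B a) :
      QueryAlgorithm n B a

/-- The matrix of one query to `U` on the oracle register and the ancillas: it applies `U` or `U†`
to the oracle register on the ancilla basis states where the control qubit, if any, is `1`, and the
identity on the others. -/
def queryMatrix {B : Type} [DecidableEq B] {a : ℕ} (U : Matrix B B ℂ)
    (adj : Bool) (ctrl : Option (Fin a)) : Matrix (B × Bits a) (B × Bits a) ℂ :=
  blockDiagonal fun w : Bits a =>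
    if ∀ c ∈ ctrl, w c = true then (if adj = true then Uᴴ else U) else 1

namespace QueryAlgorithm

variable {n : ℕ} {B : Type} [Fintype B] [DecidableEq B] {a : ℕ}

/-- The number of queries, in the worst case over the measurement outcomes. -/
def queries : QueryAlgorithm n B a → ℕ
  | output _ => 0
  | gate _ next => next.queries
  | query _ _ next => next.queries + 1
  | measure _ next => Finset.univ.sup fun r => (next r).queries

/-- `A.probFrom U v z` is the probability that `A`, run with oracle `U` on the (possibly
subnormalized) state vector `v`, outputs `z`. The squared norm of `v` is the probability of the
measurement outcomes seen so far. -/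
noncomputable def probFrom (U : Matrix B B ℂ) :
    QueryAlgorithm n B a → (B × Bits a → ℂ) → Bits n → ℝ
  | output z', v, z => if z = z' then ∑ i, ‖v i‖ ^ 2 else 0
  | gate V next, v, z => probFrom U next ((V : Matrix (B × Bits a) (B × Bits a) ℂ) *ᵥ v) z
  | query adj ctrl next, v, z => probFrom U next (queryMatrix U adj ctrl *ᵥ v) z
  | measure f next, v, z => ∑ r, probFrom U (next r) (fun i => if f i = r then v i else 0) z

/-- The probability that `A` with oracle `U` outputs `z`, when the oracle register starts in the
basis state `b₀` and the ancillas in the all-zeros state. -/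
noncomputable def prob (A : QueryAlgorithm n B a) (b₀ : B) (U : unitaryGroup B ℂ)
    (z : Bits n) : ℝ :=
  A.probFrom (U : Matrix B B ℂ) (Pi.single (b₀, zeros a) 1) z

/-- The expectation of `|⟨z|ψ⟩|²` over the output `z` of `A` with oracle `U`. -/
noncomputable def score (A : QueryAlgorithm n B a) (b₀ : B) (U : unitaryGroup B ℂ)
    (ψ : Bits n → ℂ) : ℝ :=
  ∑ z, A.prob b₀ U z * ‖ψ z‖ ^ 2

end QueryAlgorithm

/-- `U` prepares `ψ`, possibly with unentangled garbage: `U |0ⁿ⟩|g₀⟩ = |ψ⟩|φ⟩` for some state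
`φ` of the garbage register `ℂ^G`. -/
def Prepares {n : ℕ} {G : Type} [Fintype G] [DecidableEq G] (g₀ : G)
    (U : unitaryGroup (Bits n × G) ℂ) (ψ : State n) : Prop :=
  ∃ φ : Metric.sphere (0 : EuclideanSpace ℂ G) 1,
    ∀ (x : Bits n) (g : G), U (x, g) (zeros n, g₀) = ψ.1 x * φ.1 g

/-- `μ` is the joint law of a Haar-random `n`-qubit state and of a random unitary that prepares
that state (almost surely). The unitary may be chosen with additional randomness. -/
structure IsHaarPreparationLaw {n : ℕ} {G : Type} [Fintype G] [DecidableEq G] (g₀ : G)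
    (μ : Measure (State n × unitaryGroup (Bits n × G) ℂ)) : Prop where
  map_fst : μ.map Prod.fst = haarState n
  prepares : ∀ᵐ p ∂μ, Prepares g₀ p.2 p.1

/-- The vector `(|ψ⟩|1⟩ - |⊥⟩)/√2`, where `|⊥⟩ = |0ⁿ⟩|0⟩` and an `n`-qubit state `ψ` is encoded
as `|ψ⟩|1⟩`. -/
noncomputable def canonicalVector {n : ℕ} (ψ : State n) : Bits n × Bool → ℂ :=
  fun p => ((if p.2 = true then ψ.1 p.1 else 0) - (if p = (zeros n, false) then 1 else 0)) /
    (Real.sqrt 2 : ℂ)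

theorem canonicalVector_unit {n : ℕ} (ψ : State n) :
    star (canonicalVector ψ) ⬝ᵥ canonicalVector ψ = 1 := by
  have hψ : ∑ x, ‖ψ.1 x‖ ^ 2 = 1 := by
    have h : ‖ψ.1‖ = 1 := by simp
    rw [← EuclideanSpace.norm_sq_eq, h, one_pow]
  have h2 : ((Real.sqrt 2 : ℝ) : ℂ) * ((Real.sqrt 2 : ℝ) : ℂ) = 2 := by
    rw [← Complex.ofReal_mul, Real.mul_self_sqrt (by norm_num)]; norm_num
  have h0 : ((Real.sqrt 2 : ℝ) : ℂ) ≠ 0 := by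
    intro h; rw [h] at h2; norm_num at h2
  have ht : ∀ x, star (canonicalVector ψ (x, true)) * canonicalVector ψ (x, true) =
      ((‖ψ.1 x‖ ^ 2 : ℝ) : ℂ) / 2 := by
    intro x
    simp [canonicalVector, div_mul_div_comm, h2, Complex.conj_mul']
  have hf : ∀ x, star (canonicalVector ψ (x, false)) * canonicalVector ψ (x, false) =
      if x = zeros n then 1 / 2 else 0 := by
    intro x
    by_cases hx : x = zeros n <;> simp [canonicalVector, hx, div_mul_div_comm, h2]
  simp only [dotProduct, Pi.star_apply, Fintype.sum_prod_type, Fintype.sum_bool, ht, hf,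
    Finset.sum_add_distrib, ← Finset.sum_div, ← Complex.ofReal_sum, hψ]
  norm_num

/-- The reflection `1 - 2|v⟩⟨v|` about a unit vector `v`. -/
def reflection {ι : Type} [Fintype ι] [DecidableEq ι] (v : ι → ℂ) (hv : star v ⬝ᵥ v = 1) :
    unitaryGroup ι ℂ :=
  ⟨1 - (2 : ℂ) • vecMulVec v (star v), by
    rw [mem_unitaryGroup_iff, star_eq_conjTranspose, conjTranspose_sub, conjTranspose_one,
      conjTranspose_smul, conjTranspose_vecMulVec, star_star]
    have h : vecMulVec v (star v) * vecMulVec v (star v) = vecMulVec v (star v) := by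
      rw [vecMulVec_mul_vecMulVec, hv, one_smul]
    simp only [sub_mul, mul_sub, one_mul, mul_one, smul_mul_smul_comm, h, RCLike.star_def,
      map_ofNat]
    module⟩

/-- The canonical state preparation oracle `O_ψ`: the reflection about `(|ψ⟩ - |⊥⟩)/√2`. -/
noncomputable def canonicalOracle {n : ℕ} (ψ : State n) : unitaryGroup (Bits n × Bool) ℂ :=
  reflection (canonicalVector ψ) (canonicalVector_unit ψ)

end XHOG

/-! ### Basis gates used by the algorithm. -/

namespace XHOG

open MeasureTheory Matrix

/-! Write `N = 2^n`, `p z = |⟨z|ψ⟩|²` and `Q_j = ∑ p^j`. Measuring `ψ` once scores `Q_2`, about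
`2/N` on average. A string that is drawn from `p` and then drawn a second time is size-biased twice:
it has weight about `Q_3/Q_2`, that is `3/N`. The algorithm makes such collisions likely. It samples
`k` strings into a set `S`, prepares `ψ` again, runs `T` steps of amplitude amplification towards
`S` and measures. The set `S` has weight about `2k/N`, and amplification multiplies it by about
`(2T+1)²`. With `k = T ≈ N^{1/3}/4` this makes the hit probability about `1/8` at a cost of `k + 1 +
2T` queries, and each hit gains about `1/N`.

The score is a polynomial in `p` alone (`score_collisionFinder`). Estimates for the amplified
amplitudes and for the random set `S` bound it below by power sums of `p`
(`expectInsert_groverScore_ge`). Their Haar averages follow from the moments of the uniform measure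
on the complex sphere (`integral_toSphere_monomial`), and `score_bound_numeric` compares the
constants: to leading order the score is at least `(2 + 1/8 - 1/64)/N`.

The three oracle models enter only through the law of the measured string. Garbage is summed out
(`score_of_prepares`), the canonical reflection is a preparation oracle with one garbage qubit
(`prepares_canonicalOracle`), and a column of a Haar unitary is a Haar state
(`integral_column_eq_integral_haarState`). -/

/-- The unitary matrix that permutes the computational basis. -/
noncomputable def permGate {ι : Type} [Fintype ι] [DecidableEq ι] (σ : Equiv.Perm ι) :
    unitaryGroup ι ℂ :=
  ⟨σ.permMatrix ℂ, by
    rw [mem_unitaryGroup_iff, star_eq_conjTranspose, conjTranspose_permMatrix,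
      ← Matrix.permMatrix_mul]
    simp⟩

/-- The diagonal unitary matrix that flips the sign of the basis states outside `s`. -/
noncomputable def phaseGate {ι : Type} [Fintype ι] [DecidableEq ι] (s : Finset ι) :
    unitaryGroup ι ℂ :=
  ⟨diagonal fun i => if i ∈ s then 1 else -1, by
    rw [mem_unitaryGroup_iff, star_eq_conjTranspose, diagonal_conjTranspose, diagonal_mul_diagonal,
      ← diagonal_one]
    congr 1
    ext i
    by_cases h : i ∈ s <;> simp [h]⟩

/-- After a complete measurement with outcome `i`, this gate resets the register to the start state
`j`, so that the next sample is fresh. -/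
theorem permGate_swap_mulVec_single {ι : Type} [Fintype ι] [DecidableEq ι] (i j : ι) (c : ℂ) :
    (permGate (Equiv.swap i j) : Matrix ι ι ℂ) *ᵥ Pi.single i c = Pi.single j c := by
  have : (permGate (Equiv.swap i j) : Matrix ι ι ℂ) = (Equiv.swap i j).permMatrix ℂ := rfl
  rw [this, permMatrix_mulVec]
  ext x
  simp only [Function.comp_apply, Pi.single_apply]
  congr 1
  rw [Equiv.swap_apply_eq_iff, Equiv.swap_apply_left]

theorem phaseGate_mulVec {ι : Type} [Fintype ι] [DecidableEq ι] (s : Finset ι) (v : ι → ℂ) :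
    (phaseGate s : Matrix ι ι ℂ) *ᵥ v = fun i => if i ∈ s then v i else - v i := by
  have : (phaseGate s : Matrix ι ι ℂ) = diagonal fun i => if i ∈ s then 1 else -1 := rfl
  rw [this]
  ext i
  rw [mulVec_diagonal]
  split_ifs <;> simp

/-! ### Evaluation rules for the expected score. -/

namespace QueryAlgorithm

variable {n : ℕ} {B : Type} [Fintype B] [DecidableEq B] {a : ℕ}

/-- The expectation of `w z` over the output `z` of `A`, run from the vector `v`. -/
noncomputable def scoreFrom (U : Matrix B B ℂ) (A : QueryAlgorithm n B a) (v : B × Bits a → ℂ)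
    (w : Bits n → ℝ) : ℝ :=
  ∑ z, A.probFrom U v z * w z

variable (U : Matrix B B ℂ) (v : B × Bits a → ℂ) (w : Bits n → ℝ)

theorem scoreFrom_output (z : Bits n) :
    (output z : QueryAlgorithm n B a).scoreFrom U v w = (∑ i, ‖v i‖ ^ 2) * w z := by
  simp [scoreFrom, probFrom]

theorem scoreFrom_gate (V : unitaryGroup (B × Bits a) ℂ) (A : QueryAlgorithm n B a) :
    (gate V A).scoreFrom U v w = A.scoreFrom U ((V : Matrix _ _ ℂ) *ᵥ v) w := rfl

theorem scoreFrom_query (adj : Bool) (ctrl : Option (Fin a)) (A : QueryAlgorithm n B a) :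
    (query adj ctrl A).scoreFrom U v w = A.scoreFrom U (queryMatrix U adj ctrl *ᵥ v) w := rfl

theorem scoreFrom_measure_id (A : B × Bits a → QueryAlgorithm n B a) :
    (measure id A).scoreFrom U v w = ∑ r, (A r).scoreFrom U (Pi.single r (v r)) w := by
  have h : ∀ r, (fun i => if id i = r then v i else 0) = Pi.single r (v r) := by
    intro r
    ext i
    by_cases hi : i = r
    · subst hi; simp
    · simp [hi]
  simp only [scoreFrom, probFrom, h]
  rw [Finset.sum_comm]
  simp only [Finset.sum_mul]

/-- State vectors are left subnormalized after a measurement; this homogeneity extracts the outcome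
probability `‖c‖²` from the rest of the run. -/
theorem probFrom_smul (A : QueryAlgorithm n B a) (c : ℂ) (z : Bits n) :
    A.probFrom U (c • v) z = ‖c‖ ^ 2 * A.probFrom U v z := by
  induction A generalizing v with
  | output z' =>
    simp only [probFrom, Pi.smul_apply, smul_eq_mul, norm_mul, mul_pow, ← Finset.mul_sum]
    split_ifs <;> simp
  | gate V A ih => simp only [probFrom, mulVec_smul, ih]
  | query adj ctrl A ih => simp only [probFrom, mulVec_smul, ih]
  | measure f A ih =>
    simp only [probFrom, Finset.mul_sum]
    refine Finset.sum_congr rfl fun r _ => ?_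
    rw [← ih]
    congr 1
    ext i
    by_cases h : f i = r <;> simp [h]

theorem scoreFrom_single (A : QueryAlgorithm n B a) (i : B × Bits a) (c : ℂ) :
    A.scoreFrom U (Pi.single i c) w = ‖c‖ ^ 2 * A.scoreFrom U (Pi.single i 1) w := by
  have h : (Pi.single i c : B × Bits a → ℂ) = c • Pi.single i 1 := by
    rw [← Pi.single_smul]; simp
  simp only [scoreFrom, h, probFrom_smul, Finset.mul_sum, mul_assoc]

theorem score_eq_scoreFrom (A : QueryAlgorithm n B a) (b₀ : B) (U : unitaryGroup B ℂ)
    (ψ : Bits n → ℂ) :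
    A.score b₀ U ψ = A.scoreFrom U (Pi.single (b₀, zeros a) 1) fun z => ‖ψ z‖ ^ 2 := rfl

end QueryAlgorithm

/-! ### The algorithm, its query count and its exact score. -/

section CollisionFinder

variable {n : ℕ} {B : Type} [Fintype B] [DecidableEq B]

theorem queryMatrix_none_mulVec (U : Matrix B B ℂ) (adj : Bool) (f : B → ℂ) :
    queryMatrix (a := 0) U adj none *ᵥ (fun i => f i.1) =
      fun i => ((if adj = true then Uᴴ else U) *ᵥ f) i.1 := by
  ext ⟨b, w⟩
  simp only [queryMatrix, mulVec, dotProduct, blockDiagonal_apply, Fintype.sum_prod_type]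
  refine Finset.sum_congr rfl fun b' _ => ?_
  rw [Fintype.sum_subsingleton _ w]
  simp

theorem sum_prod_bits_zero {B : Type} [Fintype B] {M : Type*} [AddCommMonoid M] (f : B × Bits 0 → M) :
    ∑ i, f i = ∑ b, f (b, zeros 0) := by
  rw [Fintype.sum_prod_type]
  refine Finset.sum_congr rfl fun b' _ => ?_
  rw [Fintype.sum_subsingleton _ (zeros 0)]

theorem single_prod_bits_zero {B : Type} [DecidableEq B] (b : B) (c : ℂ) :
    (Pi.single (b, zeros 0) c : B × Bits 0 → ℂ) = fun i => (Pi.single b c : B → ℂ) i.1 := by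
  ext ⟨b', w⟩
  simp [Pi.single_apply, Prod.ext_iff, Subsingleton.elim w (zeros 0)]

/-- The law of the outcome of measuring the string `x b` after preparing `U |b₀⟩`. -/
noncomputable def outcomeLaw (x : B → Bits n) (b₀ : B) (U : Matrix B B ℂ) (z : Bits n) : ℝ :=
  ∑ b with x b = z, ‖U b b₀‖ ^ 2

theorem sum_outcomeLaw_mul {B : Type} [Fintype B] (x : B → Bits n) (b₀ : B) (U : Matrix B B ℂ) (f : Bits n → ℝ) :
    ∑ z, outcomeLaw x b₀ U z * f z = ∑ b, ‖U b b₀‖ ^ 2 * f (x b) := by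
  simp only [outcomeLaw, Finset.sum_mul]
  rw [← Finset.sum_fiberwise Finset.univ x (fun b => ‖U b b₀‖ ^ 2 * f (x b))]
  refine Finset.sum_congr rfl fun z _ => Finset.sum_congr rfl fun b hb => ?_
  rw [(Finset.mem_filter.1 hb).2]

/-- One step of amplitude amplification towards the strings in `S`. -/
noncomputable def groverStep (x : B → Bits n) (b₀ : B) (S : Finset (Bits n))
    (next : QueryAlgorithm n B 0) : QueryAlgorithm n B 0 :=
  .gate (phaseGate {i | x i.1 ∈ S}) <| .query true none <|
    .gate (phaseGate {i | i.1 ≠ b₀}) <| .query false none next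

/-- `T` steps of amplitude amplification towards `S`, followed by a measurement. -/
noncomputable def groverLoop (x : B → Bits n) (b₀ : B) (S : Finset (Bits n)) :
    ℕ → QueryAlgorithm n B 0
  | 0 => .measure id fun r => .output (x r.1)
  | T + 1 => groverStep x b₀ S (groverLoop x b₀ S T)

/-- Sample `k` strings by preparing and measuring `U |b₀⟩`, then run `T` steps of amplitude
amplification towards the set of these strings and those in `S`. -/
noncomputable def collisionFinder (x : B → Bits n) (b₀ : B) (T : ℕ) :
    ℕ → Finset (Bits n) → QueryAlgorithm n B 0
  | 0, S => .query false none <| groverLoop x b₀ S T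
  | k + 1, S => .query false none <| .measure id fun r =>
      .gate (permGate (Equiv.swap r (b₀, zeros 0))) <| collisionFinder x b₀ T k (insert (x r.1) S)

theorem queries_groverLoop (x : B → Bits n) (b₀ : B) (S : Finset (Bits n)) (T : ℕ) :
    (groverLoop x b₀ S T).queries = 2 * T := by
  induction T with
  | zero =>
    simp [groverLoop, QueryAlgorithm.queries]
  | succ T ih => simp only [groverLoop, groverStep, QueryAlgorithm.queries, ih]; omega

/-- One query per sample, one to prepare the state to be amplified, and two (`U†` and `U`) per
amplification step. -/
theorem queries_collisionFinder (x : B → Bits n) (b₀ : B) (T k : ℕ) (S : Finset (Bits n)) :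
    (collisionFinder x b₀ T k S).queries ≤ k + 1 + 2 * T := by
  induction k generalizing S with
  | zero => simp only [collisionFinder, QueryAlgorithm.queries, queries_groverLoop]; omega
  | succ k ih =>
    simp only [collisionFinder, QueryAlgorithm.queries]
    have : (Finset.univ.sup fun r : B × Bits 0 =>
        (collisionFinder x b₀ T k (insert (x r.1) S)).queries) ≤ k + 1 + 2 * T :=
      Finset.sup_le fun r _ => ih _
    omega

/-- The amplitudes of the good and of the bad component after `T` steps of amplitude amplification,
relative to the initial ones, if the good component has weight `P`. -/
def amplitudes (P : ℝ) : ℕ → ℝ × ℝ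
  | 0 => (1, 1)
  | T + 1 => ((amplitudes P T).1 * (1 - 2 * P) + 2 * (amplitudes P T).2 * (1 - P),
      (amplitudes P T).2 * (1 - 2 * P) - 2 * (amplitudes P T).1 * P)

/-- The vector `U |b₀⟩` with its good part multiplied by `c.1` and its bad part by `c.2`. -/
noncomputable def twoComponentVector (x : B → Bits n) (b₀ : B) (S : Finset (Bits n))
    (U : Matrix B B ℂ) (c : ℝ × ℝ) (b : B) : ℂ :=
  (if x b ∈ S then (c.1 : ℂ) else (c.2 : ℂ)) * U b b₀

theorem sum_norm_sq_column (U : unitaryGroup B ℂ) (b₀ : B) :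
    ∑ b, ‖(U : Matrix B B ℂ) b b₀‖ ^ 2 = 1 := by
  have h := congrFun (congrFun (mem_unitaryGroup_iff'.1 U.2) b₀) b₀
  simp only [star_eq_conjTranspose, mul_apply, conjTranspose_apply, one_apply_eq,
    RCLike.star_def, Complex.conj_mul'] at h
  exact_mod_cast h

/-- The span of the good and bad parts of `ψ = U|b₀⟩` is invariant: the first phase gate flips the
bad part, and the remaining gates compose to `U (1 - 2|b₀⟩⟨b₀|) U† = 1 - 2|ψ⟩⟨ψ|`. -/
theorem scoreFrom_groverStep (x : B → Bits n) (b₀ : B) (S : Finset (Bits n))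
    (U : unitaryGroup B ℂ) (c : ℝ × ℝ) (A : QueryAlgorithm n B 0) (w : Bits n → ℝ) :
    (groverStep x b₀ S A).scoreFrom U (fun i => twoComponentVector x b₀ S U c i.1) w =
      A.scoreFrom U (fun i => twoComponentVector x b₀ S U
        (c.1 * (1 - 2 * ∑ z ∈ S, outcomeLaw x b₀ U z) +
            2 * c.2 * (1 - ∑ z ∈ S, outcomeLaw x b₀ U z),
          c.2 * (1 - 2 * ∑ z ∈ S, outcomeLaw x b₀ U z) -
            2 * c.1 * ∑ z ∈ S, outcomeLaw x b₀ U z) i.1) w := by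
  set P := ∑ z ∈ S, outcomeLaw x b₀ U z with hP
  have hP' : ∑ b, ‖(U : Matrix B B ℂ) b b₀‖ ^ 2 * (if x b ∈ S then 1 else 0) = P := by
    rw [← sum_outcomeLaw_mul x b₀ (U : Matrix B B ℂ) (fun z => if z ∈ S then 1 else 0)]
    simp [hP]
  have h1 := sum_norm_sq_column U b₀
  set f : B → ℂ := twoComponentVector x b₀ S U (c.1, -c.2) with hf
  have hf0 : (fun i : B × Bits 0 => if i ∈ ({i | x i.1 ∈ S} : Finset (B × Bits 0)) then
      twoComponentVector x b₀ S U c i.1 else - twoComponentVector x b₀ S U c i.1) =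
      fun i => f i.1 := by
    ext i
    by_cases hi : x i.1 ∈ S <;> simp [f, twoComponentVector, hi]
  set g : B → ℂ := (U : Matrix B B ℂ)ᴴ *ᵥ f with hg
  -- This is the overlap `⟨ψ|f⟩`; the second reflection subtracts twice this multiple of `ψ`.
  have hgb : g b₀ = ((c.1 * P - c.2 * (1 - P) : ℝ) : ℂ) := by
    have : (c.1 * P - c.2 * (1 - P) : ℝ) = ∑ b, ‖(U : Matrix B B ℂ) b b₀‖ ^ 2 *
        (if x b ∈ S then c.1 else -c.2) := by
      rw [← h1, ← hP', ← Finset.sum_sub_distrib, Finset.mul_sum, Finset.mul_sum,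
        ← Finset.sum_sub_distrib]
      refine Finset.sum_congr rfl fun b _ => ?_
      split_ifs <;> ring
    rw [this]
    push_cast
    simp only [hg, hf, mulVec, dotProduct, conjTranspose_apply, twoComponentVector]
    refine Finset.sum_congr rfl fun b _ => ?_
    rw [← Complex.conj_mul']
    simp only [RCLike.star_def]
    split_ifs <;> push_cast <;> ring
  have hg0 : (fun i : B × Bits 0 => if i ∈ ({i | i.1 ≠ b₀} : Finset (B × Bits 0)) then
      g i.1 else - g i.1) = fun i => (g - (2 * g b₀) • (Pi.single b₀ 1 : B → ℂ)) i.1 := by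
    ext i
    by_cases hi : i.1 = b₀
    · simp [hi]; ring
    · simp [hi]
  simp only [groverStep, QueryAlgorithm.scoreFrom_gate, QueryAlgorithm.scoreFrom_query]
  rw [phaseGate_mulVec {i : B × Bits 0 | x i.1 ∈ S}, hf0, queryMatrix_none_mulVec, if_pos rfl, ← hg, phaseGate_mulVec, hg0,
    queryMatrix_none_mulVec, if_neg (by simp)]
  congr 1
  ext i
  have hUU : (U : Matrix B B ℂ) * (U : Matrix B B ℂ)ᴴ = 1 := mem_unitaryGroup_iff.1 U.2
  rw [mulVec_sub, mulVec_smul, mulVec_single_one, hg, mulVec_mulVec, hUU, one_mulVec, ← hg, hgb]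
  simp only [Pi.sub_apply, Pi.smul_apply, smul_eq_mul, col_apply, hf, twoComponentVector]
  split_ifs <;> push_cast <;> ring

/-- The number `s` of completed steps is general because the induction moves one step at a time from
the program into the vector. -/
theorem scoreFrom_groverLoop_twoComponentVector (x : B → Bits n) (b₀ : B) (S : Finset (Bits n))
    (U : unitaryGroup B ℂ) (T s : ℕ) (w : Bits n → ℝ) :
    (groverLoop x b₀ S T).scoreFrom U (fun i => twoComponentVector x b₀ S U
        (amplitudes (∑ z ∈ S, outcomeLaw x b₀ U z) s) i.1) w =
      (groverLoop x b₀ S 0).scoreFrom U (fun i => twoComponentVector x b₀ S U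
        (amplitudes (∑ z ∈ S, outcomeLaw x b₀ U z) (s + T)) i.1) w := by
  induction T generalizing s with
  | zero => rfl
  | succ T ih =>
    rw [show groverLoop x b₀ S (T + 1) = groverStep x b₀ S (groverLoop x b₀ S T) from rfl,
      scoreFrom_groverStep, ← Nat.add_assoc, Nat.add_right_comm, ← ih]
    rfl

/-- The expected weight of the output of `T` steps of amplitude amplification towards `S`, starting
from a state with outcome probabilities `p`. -/
def groverScore (p w : Bits n → ℝ) (T : ℕ) (S : Finset (Bits n)) : ℝ :=
  (amplitudes (∑ z ∈ S, p z) T).1 ^ 2 * ∑ z ∈ S, p z * w z +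
    (amplitudes (∑ z ∈ S, p z) T).2 ^ 2 * (∑ z, p z * w z - ∑ z ∈ S, p z * w z)

/-- The expectation of `f (S ∪ {z₁, …, z_k})` for independent samples `z₁, …, z_k` of `p`. -/
def expectInsert (p : Bits n → ℝ) (f : Finset (Bits n) → ℝ) : ℕ → Finset (Bits n) → ℝ
  | 0, S => f S
  | k + 1, S => ∑ z, p z * expectInsert p f k (insert z S)

theorem scoreFrom_groverLoop (x : B → Bits n) (b₀ : B) (S : Finset (Bits n))
    (U : unitaryGroup B ℂ) (T : ℕ) (w : Bits n → ℝ) :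
    (groverLoop x b₀ S T).scoreFrom U (fun i => (U : Matrix B B ℂ) i.1 b₀) w =
      groverScore (outcomeLaw x b₀ U) w T S := by
  have h := scoreFrom_groverLoop_twoComponentVector x b₀ S U T 0 w
  have h0 : (fun i : B × Bits 0 => twoComponentVector x b₀ S U
        (amplitudes (∑ z ∈ S, outcomeLaw x b₀ U z) 0) i.1) =
      fun i => (U : Matrix B B ℂ) i.1 b₀ := by
    ext i
    simp [twoComponentVector, amplitudes]
  rw [h0] at h
  rw [h, zero_add]
  rw [groverLoop, QueryAlgorithm.scoreFrom_measure_id]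
  simp only [QueryAlgorithm.scoreFrom_output]
  rw [groverScore]
  set c := amplitudes (∑ z ∈ S, outcomeLaw x b₀ U z) T
  have key : ∑ z, outcomeLaw x b₀ U z * ((if z ∈ S then c.1 ^ 2 else c.2 ^ 2) * w z) =
      c.1 ^ 2 * ∑ z ∈ S, outcomeLaw x b₀ U z * w z +
    c.2 ^ 2 * (∑ z, outcomeLaw x b₀ U z * w z - ∑ z ∈ S, outcomeLaw x b₀ U z * w z) := by
    rw [← Finset.sum_add_sum_compl S (fun z => outcomeLaw x b₀ U z * w z), add_sub_cancel_left,
      Finset.mul_sum, Finset.mul_sum, ← Finset.sum_add_sum_compl S]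
    congr 1
    · refine Finset.sum_congr rfl fun z hz => ?_
      rw [if_pos hz]; ring
    · refine Finset.sum_congr rfl fun z hz => ?_
      rw [if_neg (Finset.mem_compl.1 hz)]; ring
  rw [← key, sum_outcomeLaw_mul, sum_prod_bits_zero]
  refine Finset.sum_congr rfl fun b _ => ?_
  have hs : ∀ d : ℂ, ∑ i, ‖(Pi.single (b, zeros 0) d : B × Bits 0 → ℂ) i‖ ^ 2 = ‖d‖ ^ 2 := by
    intro d
    rw [Finset.sum_eq_single (b, zeros 0)]
    · simp
    · intro i _ hi; simp [hi]
    · simp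
  rw [hs, twoComponentVector]
  split_ifs <;> simp [mul_pow] <;> ring

theorem query_single (U : Matrix B B ℂ) (b₀ : B) :
    queryMatrix (a := 0) U false none *ᵥ (Pi.single (b₀, zeros 0) 1) = fun i => U i.1 b₀ := by
  rw [single_prod_bits_zero, queryMatrix_none_mulVec]
  ext i
  simp

/-- Measurement and reset bring the register back to its start state, so the rounds communicate only
through `S`. The samples are therefore independent, and the recursion is that of `expectInsert`. -/
theorem scoreFrom_collisionFinder (x : B → Bits n) (b₀ : B) (S : Finset (Bits n))
    (U : unitaryGroup B ℂ) (T k : ℕ) (w : Bits n → ℝ) :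
    (collisionFinder x b₀ T k S).scoreFrom U (Pi.single (b₀, zeros 0) 1) w =
      expectInsert (outcomeLaw x b₀ U) (groverScore (outcomeLaw x b₀ U) w T) k S := by
  induction k generalizing S with
  | zero =>
    rw [collisionFinder, QueryAlgorithm.scoreFrom_query, query_single, scoreFrom_groverLoop]
    rfl
  | succ k ih =>
    rw [collisionFinder, QueryAlgorithm.scoreFrom_query, query_single,
      QueryAlgorithm.scoreFrom_measure_id, sum_prod_bits_zero]
    simp only [QueryAlgorithm.scoreFrom_gate, permGate_swap_mulVec_single]
    simp_rw [fun b S => QueryAlgorithm.scoreFrom_single U.1 w (collisionFinder x b₀ T k S)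
      (b₀, zeros 0) (U.1 b b₀), ih]
    rw [← sum_outcomeLaw_mul x b₀ U.1 (fun z => expectInsert (outcomeLaw x b₀ U)
      (groverScore (outcomeLaw x b₀ U) w T) k (insert z S))]
    rfl

/-- If measuring `U |b₀⟩` yields the output distribution of `ψ`, then the score of the collision
finder depends on that distribution only. -/
theorem score_collisionFinder (x : B → Bits n) (b₀ : B) (U : unitaryGroup B ℂ) (T k : ℕ)
    (ψ : Bits n → ℂ) (h : ∀ z, outcomeLaw x b₀ U z = ‖ψ z‖ ^ 2) :
    (collisionFinder x b₀ T k ∅).score b₀ U ψ =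
      expectInsert (fun z => ‖ψ z‖ ^ 2)
        (groverScore (fun z => ‖ψ z‖ ^ 2) (fun z => ‖ψ z‖ ^ 2) T) k ∅ := by
  rw [QueryAlgorithm.score_eq_scoreFrom, scoreFrom_collisionFinder,
    show outcomeLaw x b₀ U = fun z => ‖ψ z‖ ^ 2 from funext h]

end CollisionFinder

/-! ### Bounds for amplitude amplification. -/

section Amplitudes

variable {P : ℝ}

/-- Conservation of total probability. With `P = sin² θ` the two amplitudes are `sin((2T+1)θ)/sin θ`
and `cos((2T+1)θ)/cos θ`; the bounds below are Taylor estimates of these, obtained from the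
recursion without trigonometry. -/
theorem amplitudes_norm (P : ℝ) (T : ℕ) :
    (amplitudes P T).1 ^ 2 * P + (amplitudes P T).2 ^ 2 * (1 - P) = 1 := by
  induction T with
  | zero => simp [amplitudes]
  | succ T ih =>
    simp only [amplitudes]
    linear_combination ih

theorem abs_amplitudes_snd_mul_le (h0 : 0 ≤ P) (h1 : P ≤ 1) (T : ℕ) :
    |(amplitudes P T).2 * (1 - P)| ≤ 1 := by
  have h := amplitudes_norm P T
  rw [← sq_le_one_iff_abs_le_one]
  have h2 : (amplitudes P T).2 ^ 2 * (1 - P) ≤ 1 := by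
    nlinarith [mul_nonneg (sq_nonneg (amplitudes P T).1) h0]
  nlinarith [mul_nonneg (mul_nonneg (sq_nonneg (amplitudes P T).2) (sub_nonneg.2 h1)) h0]

theorem abs_amplitudes_fst_le (h0 : 0 ≤ P) (h1 : P ≤ 1) (T : ℕ) :
    |(amplitudes P T).1| ≤ 2 * T + 1 := by
  induction T with
  | zero => simp [amplitudes]
  | succ T ih =>
    have hb := abs_amplitudes_snd_mul_le h0 h1 T
    have hP : |1 - 2 * P| ≤ 1 := abs_le.2 ⟨by linarith, by linarith⟩
    simp only [amplitudes]
    calc _ ≤ |(amplitudes P T).1 * (1 - 2 * P)| + |2 * (amplitudes P T).2 * (1 - P)| :=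
          abs_add_le _ _
      _ ≤ (2 * T + 1) * 1 + 2 * 1 := by
          rw [abs_mul, mul_assoc, abs_mul 2, abs_two]
          gcongr
      _ = _ := by push_cast; ring

/-- The step from `T` to `T + 1` lowers the left factor by at most `2P + 2P(2T+1) = 4P(T+1)`. The
factor `1 - P` is kept because this is the combination in which the bad amplitude feeds the good
one. -/
theorem amplitudes_snd_mul_ge (h0 : 0 ≤ P) (h1 : P ≤ 1) (T : ℕ) :
    1 - P * (2 * T ^ 2 + 2 * T + 1) ≤ (amplitudes P T).2 * (1 - P) := by
  induction T with
  | zero => simp [amplitudes]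
  | succ T ih =>
    have ha := (abs_le.1 (abs_amplitudes_fst_le h0 h1 T)).2
    have hb := (abs_le.1 (abs_amplitudes_snd_mul_le h0 h1 T)).2
    have e1 : P * ((amplitudes P T).2 * (1 - P)) ≤ P * 1 := by gcongr
    have e2 : P * (1 - P) * (amplitudes P T).1 ≤ P * (1 - P) * (2 * T + 1) :=
      mul_le_mul_of_nonneg_left ha (mul_nonneg h0 (sub_nonneg.2 h1))
    have e3 : P * (1 - P) * (2 * T + 1) ≤ P * 1 * (2 * T + 1) := by gcongr; linarith
    simp only [amplitudes]
    push_cast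
    nlinarith

theorem amplitudes_fst_ge (h0 : 0 ≤ P) (h1 : P ≤ 1) (T : ℕ) :
    (2 * T + 1 : ℝ) - P * (2 * T + 1) ^ 3 / 6 ≤ (amplitudes P T).1 := by
  -- The coefficient of `P` is `4(1² + ⋯ + T²)`: step `t` adds `2` and loses at most `4Pt²`.
  have h : (2 * T + 1 : ℝ) - P * (2 / 3 * T * (T + 1) * (2 * T + 1)) ≤ (amplitudes P T).1 := by
    induction T with
    | zero => simp [amplitudes]
    | succ T ih =>
      have ha := (abs_le.1 (abs_amplitudes_fst_le h0 h1 T)).2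
      have hb := amplitudes_snd_mul_ge h0 h1 T
      have e1 : P * (amplitudes P T).1 ≤ P * (2 * T + 1) := by gcongr
      simp only [amplitudes]
      push_cast
      nlinarith
  refine le_trans ?_ h
  have : 0 ≤ P * (2 * T + 1) := by positivity
  nlinarith

theorem amplitudes_fst_sq_le (h0 : 0 ≤ P) (h1 : P ≤ 1) (T : ℕ) :
    (amplitudes P T).1 ^ 2 ≤ (2 * T + 1 : ℝ) ^ 2 :=
  sq_le_sq' (abs_le.1 (abs_amplitudes_fst_le h0 h1 T)).1
    (abs_le.1 (abs_amplitudes_fst_le h0 h1 T)).2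

theorem amplitudes_fst_sq_ge (h0 : 0 ≤ P) (h1 : P ≤ 1) (T : ℕ) :
    (2 * T + 1 : ℝ) ^ 2 - P * (2 * T + 1) ^ 4 / 3 ≤ (amplitudes P T).1 ^ 2 := by
  have h := amplitudes_fst_ge h0 h1 T
  set m : ℝ := 2 * T + 1
  -- A nonnegative lower bound can be squared; otherwise the claimed bound is itself nonpositive.
  rcases le_total 0 (m - P * m ^ 3 / 6) with h' | h'
  · have := mul_self_le_mul_self h' h
    nlinarith [sq_nonneg (P * m ^ 3 / 6)]
  · have hm : 0 ≤ m := by positivity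
    nlinarith [sq_nonneg (amplitudes P T).1, mul_nonneg hm (neg_nonneg.2 h'), sq_nonneg m]

theorem amplitudes_snd_sq_ge (h0 : 0 ≤ P) (h1 : P ≤ 1) (T : ℕ) :
    1 - (2 * T + 1 : ℝ) ^ 2 * P ≤ (amplitudes P T).2 ^ 2 := by
  have h := amplitudes_norm P T
  have h2 := mul_le_mul_of_nonneg_right (amplitudes_fst_sq_le h0 h1 T) h0
  nlinarith [mul_nonneg (sq_nonneg (amplitudes P T).2) h0]

end Amplitudes

/-! ### Expectations over the random sample set. -/

section Sampling

variable {n : ℕ} {p : Bits n → ℝ}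

/-- The amplitude bounds are inserted and the nonnegative cross term `(2T+1)² P A` is dropped. What
remains is affine in `A`, `P A` and `P`, where `P` and `A` are the sums of `p` and `p²` over `S`, so
three expectations suffice. -/
theorem groverScore_ge (hp : ∀ z, 0 ≤ p z) (hs : ∑ z, p z = 1) (T : ℕ) (S : Finset (Bits n)) :
    ((2 * T + 1 : ℝ) ^ 2 - 1) * ∑ z ∈ S, p z ^ 2 +
        (-((2 * T + 1 : ℝ) ^ 4 / 3)) * ((∑ z ∈ S, p z) * ∑ z ∈ S, p z ^ 2) +
        (-((2 * T + 1 : ℝ) ^ 2 * ∑ z, p z ^ 2)) * (∑ z ∈ S, p z) + ∑ z, p z ^ 2 ≤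
      groverScore p p T S := by
  have h0 : 0 ≤ ∑ z ∈ S, p z := Finset.sum_nonneg fun z _ => hp z
  have h1 : ∑ z ∈ S, p z ≤ 1 := by
    rw [← hs]
    exact Finset.sum_le_sum_of_subset_of_nonneg (Finset.subset_univ S) fun z _ _ => hp z
  have hA : 0 ≤ ∑ z ∈ S, p z ^ 2 := Finset.sum_nonneg fun z _ => sq_nonneg _
  have hB : ∑ z ∈ S, p z ^ 2 ≤ ∑ z, p z ^ 2 :=
    Finset.sum_le_sum_of_subset_of_nonneg (Finset.subset_univ S) fun z _ _ => sq_nonneg _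
  simp only [groverScore, ← sq]
  set P := ∑ z ∈ S, p z
  set A := ∑ z ∈ S, p z ^ 2
  have e1 := mul_le_mul_of_nonneg_right (amplitudes_fst_sq_ge h0 h1 T) hA
  have e2 := mul_le_mul_of_nonneg_right (amplitudes_snd_sq_ge h0 h1 T) (sub_nonneg.2 hB)
  have e3 : 0 ≤ (2 * T + 1 : ℝ) ^ 2 * P * A := by positivity
  nlinarith

theorem expectInsert_mono (hp : ∀ z, 0 ≤ p z) {f g : Finset (Bits n) → ℝ} (h : ∀ S, f S ≤ g S)
    (k : ℕ) (S : Finset (Bits n)) : expectInsert p f k S ≤ expectInsert p g k S := by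
  induction k generalizing S with
  | zero => exact h S
  | succ k ih => exact Finset.sum_le_sum fun z _ => mul_le_mul_of_nonneg_left (ih _) (hp z)

theorem expectInsert_linear (hs : ∑ z, p z = 1) (a b c d : ℝ) (f g h : Finset (Bits n) → ℝ)
    (k : ℕ) (S : Finset (Bits n)) :
    expectInsert p (fun S => a * f S + b * g S + c * h S + d) k S =
      a * expectInsert p f k S + b * expectInsert p g k S + c * expectInsert p h k S + d := by
  induction k generalizing S with
  | zero => rfl
  | succ k ih =>
    simp only [expectInsert, ih]
    rw [Finset.mul_sum, Finset.mul_sum, Finset.mul_sum]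
    conv_rhs => rw [← one_mul d, ← hs, Finset.sum_mul]
    simp only [← Finset.sum_add_distrib]
    exact Finset.sum_congr rfl fun z _ => by ring

theorem sum_mul_cubic (hs : ∑ z, p z = 1) (c₀ c₁ c₂ c₃ : ℝ) :
    ∑ z, p z * (c₀ + c₁ * p z + c₂ * p z ^ 2 + c₃ * p z ^ 3) =
      c₀ + c₁ * ∑ z, p z ^ 2 + c₂ * ∑ z, p z ^ 3 + c₃ * ∑ z, p z ^ 4 := by
  conv_rhs => rw [← mul_one c₀, ← hs]
  simp only [Finset.mul_sum, ← Finset.sum_add_distrib]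
  exact Finset.sum_congr rfl fun z _ => by ring

theorem sum_insert_le (hp : ∀ z, 0 ≤ p z) (j : ℕ) (z : Bits n) (S : Finset (Bits n)) :
    ∑ y ∈ insert z S, p y ^ j ≤ ∑ y ∈ S, p y ^ j + p z ^ j := by
  by_cases h : z ∈ S
  · rw [Finset.insert_eq_of_mem h]
    exact le_add_of_nonneg_right (pow_nonneg (hp z) j)
  · rw [Finset.sum_insert h, add_comm]

/-- A union bound: repeated samples are counted with multiplicity. -/
theorem expectInsert_sum_le (hp : ∀ z, 0 ≤ p z) (hs : ∑ z, p z = 1) (k : ℕ)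
    (S : Finset (Bits n)) :
    expectInsert p (fun S => ∑ z ∈ S, p z) k S ≤ ∑ z ∈ S, p z + k * ∑ z, p z ^ 2 := by
  induction k generalizing S with
  | zero => simp [expectInsert]
  | succ k ih =>
    calc _ ≤ ∑ z, p z * ((∑ y ∈ S, p y + k * ∑ z, p z ^ 2) + 1 * p z + 0 * p z ^ 2 + 0 * p z ^ 3) :=
          Finset.sum_le_sum fun z _ => mul_le_mul_of_nonneg_left ((ih _).trans (by
            have := sum_insert_le hp 1 z S
            simp only [pow_one] at this
            linarith)) (hp z)
      _ = _ := by rw [sum_mul_cubic hs]; push_cast; ring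

/-- Each sample contributes `Q_3` on average unless it repeats. Repeating an element of the given
`S` costs at most `k ∑_S p³`, and repetitions among the new samples cost at most `k² Q_4`. -/
theorem expectInsert_sum_sq_ge (hp : ∀ z, 0 ≤ p z) (hs : ∑ z, p z = 1) (k : ℕ)
    (S : Finset (Bits n)) :
    ∑ z ∈ S, p z ^ 2 + k * ∑ z, p z ^ 3 - k * ∑ z ∈ S, p z ^ 3 - k ^ 2 * ∑ z, p z ^ 4 ≤
      expectInsert p (fun S => ∑ z ∈ S, p z ^ 2) k S := by
  induction k generalizing S with
  | zero => simp [expectInsert]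
  | succ k ih =>
    have hQ : 0 ≤ ∑ z, p z ^ 4 := Finset.sum_nonneg fun z _ => pow_nonneg (hp z) 4
    calc _ ≤ ∑ z, p z * ((∑ y ∈ S, p y ^ 2 + k * ∑ z, p z ^ 3 - k * ∑ z ∈ S, p z ^ 3 -
            k ^ 2 * ∑ z, p z ^ 4) + 0 * p z + 1 * p z ^ 2 + (-k) * p z ^ 3) -
            ∑ z ∈ S, p z ^ 3 := by
          rw [sum_mul_cubic hs]; push_cast; nlinarith [Nat.cast_nonneg (α := ℝ) k]
      _ = ∑ z, p z * ((∑ y ∈ S, p y ^ 2 + k * ∑ z, p z ^ 3 - k * ∑ z ∈ S, p z ^ 3 -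
            k ^ 2 * ∑ z, p z ^ 4) + p z ^ 2 - k * p z ^ 3 - if z ∈ S then p z ^ 2 else 0) := by
          have : ∑ z ∈ S, p z ^ 3 = ∑ z, p z * (if z ∈ S then p z ^ 2 else 0) := by
            simp only [mul_ite, mul_zero, Finset.sum_ite_mem, Finset.univ_inter]
            exact Finset.sum_congr rfl fun z _ => by ring
          rw [this, ← Finset.sum_sub_distrib]
          exact Finset.sum_congr rfl fun z _ => by ring
      _ ≤ _ := Finset.sum_le_sum fun z _ => mul_le_mul_of_nonneg_left (le_trans (by
            have h3 := mul_le_mul_of_nonneg_left (sum_insert_le hp 3 z S)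
              (Nat.cast_nonneg (α := ℝ) k)
            have h2 : ∑ y ∈ insert z S, p y ^ 2 =
                ∑ y ∈ S, p y ^ 2 + p z ^ 2 - if z ∈ S then p z ^ 2 else 0 := by
              by_cases h : z ∈ S
              · rw [Finset.insert_eq_of_mem h, if_pos h]; ring
              · rw [Finset.sum_insert h, if_neg h]; ring
            rw [h2]
            linarith) (ih (insert z S))) (hp z)

/-- The product is expanded over pairs of samples: equal indices give `Q_4` each, distinct ones `Q_2
Q_3`, and the other terms pair a sample with `S`. -/
theorem expectInsert_sum_mul_sum_sq_le (hp : ∀ z, 0 ≤ p z) (hs : ∑ z, p z = 1) (k : ℕ)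
    (S : Finset (Bits n)) :
    expectInsert p (fun S => (∑ z ∈ S, p z) * ∑ z ∈ S, p z ^ 2) k S ≤
      (∑ z ∈ S, p z) * (∑ z ∈ S, p z ^ 2) + k * ((∑ z, p z ^ 2) * (∑ z ∈ S, p z ^ 2) +
        (∑ z, p z ^ 3) * (∑ z ∈ S, p z) + ∑ z, p z ^ 4) +
        k ^ 2 * ((∑ z, p z ^ 2) * ∑ z, p z ^ 3) := by
  induction k generalizing S with
  | zero => simp [expectInsert]
  | succ k ih =>
    have hQ2 : 0 ≤ ∑ z, p z ^ 2 := Finset.sum_nonneg fun z _ => pow_nonneg (hp z) 2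
    have hQ3 : 0 ≤ ∑ z, p z ^ 3 := Finset.sum_nonneg fun z _ => pow_nonneg (hp z) 3
    have hQ := mul_nonneg hQ2 hQ3
    set Q2 := ∑ z, p z ^ 2
    set Q3 := ∑ z, p z ^ 3
    set Q4 := ∑ z, p z ^ 4
    set A := ∑ z ∈ S, p z ^ 2
    set P := ∑ z ∈ S, p z
    have hk := Nat.cast_nonneg (α := ℝ) k
    calc _ ≤ ∑ z, p z * ((P * A + k * (Q2 * A + Q3 * P + Q4) + k ^ 2 * (Q2 * Q3)) +
            (A + k * Q3) * p z + (P + k * Q2) * p z ^ 2 + 1 * p z ^ 3) :=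
          Finset.sum_le_sum fun z _ => mul_le_mul_of_nonneg_left ((ih _).trans (by
            have h1 := sum_insert_le hp 1 z S
            simp only [pow_one] at h1
            have h2 := sum_insert_le hp 2 z S
            have hA : 0 ≤ ∑ y ∈ insert z S, p y ^ 2 :=
              Finset.sum_nonneg fun z _ => pow_nonneg (hp z) 2
            have hP : 0 ≤ P + p z := add_nonneg (Finset.sum_nonneg fun z _ => hp z) (hp z)
            have hmul := mul_le_mul h1 h2 hA hP
            have e1 := mul_le_mul_of_nonneg_left h2 (mul_nonneg hk hQ2)
            have e2 := mul_le_mul_of_nonneg_left h1 (mul_nonneg hk hQ3)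
            linarith)) (hp z)
      _ ≤ _ := by rw [sum_mul_cubic hs]; push_cast; nlinarith

/-- A lower bound for the score of the collision finder in terms of power sums of the output
distribution. -/
theorem expectInsert_groverScore_ge (hp : ∀ z, 0 ≤ p z) (hs : ∑ z, p z = 1) (T k : ℕ) :
    ((2 * T + 1 : ℝ) ^ 2 - 1) * (k * ∑ z, p z ^ 3 - k ^ 2 * ∑ z, p z ^ 4) -
        (2 * T + 1 : ℝ) ^ 4 / 3 *
          (k * ∑ z, p z ^ 4 + k ^ 2 * ((∑ z, p z ^ 2) * ∑ z, p z ^ 3)) -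
        (2 * T + 1 : ℝ) ^ 2 * k * (∑ z, p z ^ 2) ^ 2 + ∑ z, p z ^ 2 ≤
      expectInsert p (groverScore p p T) k ∅ := by
  refine le_trans ?_ (expectInsert_mono hp (groverScore_ge hp hs T) k ∅)
  rw [expectInsert_linear hs]
  have h1 := expectInsert_sum_le hp hs k ∅
  have h2 := expectInsert_sum_sq_ge hp hs k ∅
  have h3 := expectInsert_sum_mul_sum_sq_le hp hs k ∅
  simp only [Finset.sum_empty, mul_zero, zero_add, sub_zero, add_zero] at h1 h2 h3
  have hQ2 : 0 ≤ ∑ z, p z ^ 2 := Finset.sum_nonneg fun z _ => pow_nonneg (hp z) 2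
  have hT := Nat.cast_nonneg (α := ℝ) T
  have hm : (0 : ℝ) ≤ (2 * T + 1) ^ 2 - 1 := by nlinarith
  have e1 := mul_le_mul_of_nonneg_left h1 (mul_nonneg (sq_nonneg (2 * T + 1 : ℝ)) hQ2)
  have e2 := mul_le_mul_of_nonneg_left h2 hm
  have e3 := mul_le_mul_of_nonneg_left h3 (by positivity : (0 : ℝ) ≤ (2 * T + 1) ^ 4 / 3)
  linarith

end Sampling

/-! ### Continuity of the score, for integrability over the sphere. -/

section Continuity

variable {n : ℕ}

theorem continuous_amplitudes (T : ℕ) : Continuous fun P => amplitudes P T := by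
  induction T with
  | zero => exact continuous_const
  | succ T ih =>
    simp only [amplitudes]
    fun_prop

theorem continuous_groverScore (T : ℕ) (S : Finset (Bits n)) :
    Continuous fun p : Bits n → ℝ => groverScore p p T S := by
  have h : Continuous fun p : Bits n → ℝ => amplitudes (∑ z ∈ S, p z) T :=
    (continuous_amplitudes T).comp (by fun_prop)
  unfold groverScore
  fun_prop

theorem continuous_expectInsert_groverScore (T k : ℕ) (S : Finset (Bits n)) :
    Continuous fun p : Bits n → ℝ => expectInsert p (groverScore p p T) k S := by
  induction k generalizing S with
  | zero => exact continuous_groverScore T S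
  | succ k ih =>
    simp only [expectInsert]
    fun_prop

end Continuity

/-! ### Moments of the uniform measure on the complex sphere. -/

section SphereMoments

variable {ι : Type} [Fintype ι]

theorem integral_complex_pow_mul_exp (a : ℕ) :
    ∫ x : ℂ, (‖x‖ ^ 2) ^ a * Real.exp (-‖x‖ ^ 2) = Real.pi * a.factorial := by
  have h := Complex.integral_rpow_mul_exp_neg_rpow (p := 2) (q := 2 * a) (by norm_num)
    (by have := Nat.cast_nonneg (α := ℝ) a; linarith)
  rw [show ((2 * a + 2 : ℝ) / 2) = a + 1 by ring, Real.Gamma_nat_eq_factorial,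
    mul_div_cancel_left₀ _ two_ne_zero] at h
  rw [← h]
  refine integral_congr_ae (Filter.Eventually.of_forall fun x => ?_)
  simp only [Real.rpow_two]
  rw [Real.rpow_mul (norm_nonneg x), Real.rpow_two, Real.rpow_natCast]

theorem integral_pow_mul_exp_neg_sq (m : ℕ) :
    ∫ r in Set.Ioi (0 : ℝ), r ^ (2 * m + 1) * Real.exp (-r ^ 2) = m.factorial / 2 := by
  have h := integral_rpow_mul_exp_neg_rpow (p := 2) (q := 2 * m + 1) (by norm_num)
    (by have := Nat.cast_nonneg (α := ℝ) m; linarith)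
  rw [show ((2 * m + 1 + 1 : ℝ) / 2) = m + 1 by ring, Real.Gamma_nat_eq_factorial] at h
  rw [show (m.factorial / 2 : ℝ) = 1 / 2 * m.factorial by ring, ← h]
  refine setIntegral_congr_fun measurableSet_Ioi fun x hx => ?_
  simp only [Real.rpow_two]
  congr 1
  exact_mod_cast (Real.rpow_natCast x (2 * m + 1)).symm

/-- The Gaussian integral of a monomial in the squared moduli of the coordinates. -/
theorem exists_integral_gaussian_monomial (μ : Measure (EuclideanSpace ℂ ι))
    [μ.IsAddHaarMeasure] :
    ∃ c : ℝ, ∀ a : ι → ℕ, ∫ x, (∏ i, (‖x i‖ ^ 2) ^ a i) * Real.exp (-‖x‖ ^ 2) ∂μ =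
      c * ∏ i, ((a i).factorial : ℝ) := by
  let L : (ι → ℂ) ≃L[ℝ] EuclideanSpace ℂ ι := (PiLp.continuousLinearEquiv 2 ℝ fun _ => ℂ).symm
  have hL : (Measure.map L volume).IsAddHaarMeasure := inferInstance
  have hμ := Measure.isAddLeftInvariant_eq_smul μ (Measure.map L volume)
  set c := Measure.addHaarScalarFactor μ (Measure.map L volume)
  refine ⟨c * Real.pi ^ Fintype.card ι, fun a => ?_⟩
  rw [hμ, integral_smul_nnreal_measure]
  have he : MeasurableEmbedding L := L.toHomeomorph.measurableEmbedding
  rw [he.integral_map]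
  have h : ∀ x : ι → ℂ, (∏ i, (‖L x i‖ ^ 2) ^ a i) * Real.exp (-‖L x‖ ^ 2) =
      ∏ i, ((‖x i‖ ^ 2) ^ a i * Real.exp (-‖x i‖ ^ 2)) := by
    intro x
    rw [EuclideanSpace.norm_sq_eq, ← Finset.sum_neg_distrib, Real.exp_sum,
      ← Finset.prod_mul_distrib]
    rfl
  simp only [h]
  rw [integral_fintype_prod_volume_eq_prod
    (fun i (x : ℂ) => (‖x‖ ^ 2) ^ a i * Real.exp (-‖x‖ ^ 2))]
  simp only [integral_complex_pow_mul_exp, Finset.prod_mul_distrib, Finset.prod_const,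
    Finset.card_univ]
  rw [NNReal.smul_def, smul_eq_mul, mul_assoc]

theorem finrank_euclideanSpace_complex :
    Module.finrank ℝ (EuclideanSpace ℂ ι) = 2 * Fintype.card ι := by
  rw [← Module.finrank_mul_finrank ℝ ℂ, Complex.finrank_real_complex, finrank_euclideanSpace]

/-- The same Gaussian integral in polar coordinates. Comparison with the product form, for `a` and
for `a = 0`, eliminates the unknown constant and leaves the sphere moment. -/
theorem integral_gaussian_monomial_polar [Nonempty ι] (μ : Measure (EuclideanSpace ℂ ι))
    [μ.IsAddHaarMeasure] (a : ι → ℕ) :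
    ∫ x, (∏ i, (‖x i‖ ^ 2) ^ a i) * Real.exp (-‖x‖ ^ 2) ∂μ =
      (∫ x : Metric.sphere (0 : EuclideanSpace ℂ ι) 1, ∏ i, (‖x.1 i‖ ^ 2) ^ a i ∂μ.toSphere) *
        ((Fintype.card ι - 1 + ∑ i, a i).factorial / 2) := by
  set f : EuclideanSpace ℂ ι → ℝ := fun x => (∏ i, (‖x i‖ ^ 2) ^ a i) * Real.exp (-‖x‖ ^ 2)
  set g : Metric.sphere (0 : EuclideanSpace ℂ ι) 1 → ℝ := fun x => ∏ i, (‖x.1 i‖ ^ 2) ^ a i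
  set d := Module.finrank ℝ (EuclideanSpace ℂ ι) with hd
  have hcard : 0 < Fintype.card ι := Fintype.card_pos
  -- The real dimension is even, so the radial exponent is odd and the radial integral is half a
  -- factorial.
  have hd' : d - 1 + 2 * ∑ i, a i = 2 * (Fintype.card ι - 1 + ∑ i, a i) + 1 := by
    rw [hd, finrank_euclideanSpace_complex]; omega
  calc ∫ x, f x ∂μ = ∫ x : ({(0)}ᶜ : Set (EuclideanSpace ℂ ι)), f x.1 ∂(μ.comap (↑)) := by
        rw [integral_subtype_comap (measurableSet_singleton _).compl f, restrict_compl_singleton]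
    _ = ∫ y, f (y.2.1 • y.1.1) ∂μ.toSphere.prod (.volumeIoiPow (d - 1)) := by
        rw [← μ.measurePreserving_homeomorphUnitSphereProd.integral_comp
          (Homeomorph.measurableEmbedding _)]
        refine integral_congr_ae (Filter.Eventually.of_forall fun x => ?_)
        simp only
        rw [← homeomorphUnitSphereProd_symm_apply_coe, Homeomorph.symm_apply_apply]
    _ = ∫ y, g y.1 * ((y.2.1 ^ 2) ^ (∑ i, a i) * Real.exp (-y.2.1 ^ 2))
          ∂μ.toSphere.prod (.volumeIoiPow (d - 1)) := by
        refine integral_congr_ae (Filter.Eventually.of_forall fun y => ?_)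
        have hy : ‖y.1.1‖ = 1 := by simp
        have hr : ‖y.2.1‖ ^ 2 = y.2.1 ^ 2 := by simp
        simp only [f, g, norm_smul, hy, mul_one, PiLp.smul_apply, mul_pow, hr,
          Finset.prod_mul_distrib, Finset.prod_pow_eq_pow_sum]
        ring
    _ = (∫ x, g x ∂μ.toSphere) * ∫ r, ((r.1 ^ 2) ^ (∑ i, a i) * Real.exp (-r.1 ^ 2))
          ∂(Measure.volumeIoiPow (d - 1)) :=
        integral_prod_mul g fun r : Set.Ioi (0 : ℝ) =>
          (r.1 ^ 2) ^ (∑ i, a i) * Real.exp (-r.1 ^ 2)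
    _ = _ := by
        congr 1
        rw [← integral_pow_mul_exp_neg_sq, ← hd']
        simp only [Measure.volumeIoiPow, ENNReal.ofReal]
        rw [integral_withDensity_eq_integral_smul,
          integral_subtype_comap measurableSet_Ioi fun r : ℝ => Real.toNNReal (r ^ (d - 1)) •
            ((r ^ 2) ^ (∑ i, a i) * Real.exp (-r ^ 2)),
          setIntegral_congr_fun measurableSet_Ioi fun x hx ↦ ?_]
        · rw [NNReal.smul_def, Real.coe_toNNReal _ (pow_nonneg hx.out.le _), smul_eq_mul, pow_add,
            pow_mul, mul_assoc]
        · exact (measurable_subtype_coe.pow_const _).real_toNNReal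

/-- Moments of the uniform distribution on the complex unit sphere. -/
theorem integral_toSphere_monomial [Nonempty ι] (μ : Measure (EuclideanSpace ℂ ι))
    [μ.IsAddHaarMeasure] (a : ι → ℕ) :
    ∫ x : Metric.sphere (0 : EuclideanSpace ℂ ι) 1, ∏ i, (‖x.1 i‖ ^ 2) ^ a i ∂μ.toSphere =
      μ.toSphere.real Set.univ * ((Fintype.card ι - 1).factorial * (∏ i, ((a i).factorial : ℝ)) /
        (Fintype.card ι - 1 + ∑ i, a i).factorial) := by
  obtain ⟨c, hc⟩ := exists_integral_gaussian_monomial μ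
  have h0 := integral_gaussian_monomial_polar μ (fun _ => 0)
  have ha := integral_gaussian_monomial_polar μ a
  rw [hc] at h0 ha
  simp only [pow_zero, Finset.prod_const_one, integral_const, smul_eq_mul, mul_one,
    Finset.sum_const_zero, add_zero, Nat.factorial_zero, Nat.cast_one] at h0
  have h1 : ((Fintype.card ι - 1 + ∑ i, a i).factorial : ℝ) ≠ 0 := by positivity
  rw [h0] at ha
  rw [mul_div_assoc, ← mul_assoc, mul_div_assoc', eq_div_iff h1]
  linear_combination (-2) * ha

end SphereMoments

/-! ### The Haar-random state as a probability measure. -/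

section HaarState

variable (n : ℕ)

theorem toSphere_univ_ne_zero :
    (Measure.addHaar : Measure (EuclideanSpace ℂ (Bits n))).toSphere Set.univ ≠ 0 := by
  rw [Ne, Measure.measure_univ_eq_zero]
  exact Measure.toSphere_ne_zero _

instance isProbabilityMeasure_haarState : IsProbabilityMeasure (haarState n) :=
  ⟨by
    rw [haarState, Measure.smul_apply, smul_eq_mul]
    exact ENNReal.inv_mul_cancel (toSphere_univ_ne_zero n) (measure_ne_top _ _)⟩

variable {n}

theorem integral_haarState_monomial (a : Bits n → ℕ) :
    ∫ ψ, ∏ z, (‖ψ.1 z‖ ^ 2) ^ a z ∂haarState n =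
      (2 ^ n - 1).factorial * (∏ z, ((a z).factorial : ℝ)) /
        (2 ^ n - 1 + ∑ z, a z).factorial := by
  rw [haarState, integral_smul_measure, integral_toSphere_monomial, ENNReal.toReal_inv,
    measureReal_def, smul_eq_mul, ← mul_assoc, inv_mul_cancel₀, one_mul]
  · simp
  · exact ENNReal.toReal_ne_zero.2 ⟨toSphere_univ_ne_zero n, measure_ne_top _ _⟩

theorem integrable_haarState_of_continuous {f : State n → ℝ} (hf : Continuous f) :
    Integrable f (haarState n) := by
  rw [← integrableOn_univ]
  exact hf.continuousOn.integrableOn_compact isCompact_univ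

theorem sum_norm_sq_state (ψ : State n) : ∑ z, ‖ψ.1 z‖ ^ 2 = 1 := by
  rw [← EuclideanSpace.norm_sq_eq, norm_eq_of_mem_sphere ψ, one_pow]

end HaarState

/-! ### Haar averages of the power sums. -/

section PowerSums

variable {n : ℕ}

theorem integral_haarState_pow (z : Bits n) (j : ℕ) :
    ∫ ψ, (‖ψ.1 z‖ ^ 2) ^ j ∂haarState n =
      (2 ^ n - 1).factorial * j.factorial / (2 ^ n - 1 + j).factorial := by
  have h := integral_haarState_monomial (n := n) (Pi.single z j)
  have h1 : ∀ f : Bits n → ℝ, ∏ y, f y ^ (Pi.single z j : Bits n → ℕ) y = f z ^ j := by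
    intro f
    rw [Finset.prod_eq_single z] <;> simp +contextual
  have h2 : ∏ y, (((Pi.single z j : Bits n → ℕ) y).factorial : ℝ) = j.factorial := by
    rw [Finset.prod_eq_single z] <;> simp +contextual
  rw [h2, Finset.sum_pi_single'] at h
  simpa [h1] using h

theorem integral_haarState_pow_mul_pow {y z : Bits n} (hyz : y ≠ z) (i j : ℕ) :
    ∫ ψ, (‖ψ.1 y‖ ^ 2) ^ i * (‖ψ.1 z‖ ^ 2) ^ j ∂haarState n =
      (2 ^ n - 1).factorial * (i.factorial * j.factorial) / (2 ^ n - 1 + (i + j)).factorial := by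
  have h := integral_haarState_monomial (n := n) (Pi.single y i + Pi.single z j)
  have h1 : ∀ f : Bits n → ℝ,
      ∏ x, f x ^ (Pi.single y i + Pi.single z j : Bits n → ℕ) x = f y ^ i * f z ^ j := by
    intro f
    simp only [Pi.add_apply, pow_add, Finset.prod_mul_distrib]
    congr 1
    · rw [Finset.prod_eq_single y] <;> simp +contextual
    · rw [Finset.prod_eq_single z] <;> simp +contextual
  have h2 : ∏ x, (((Pi.single y i + Pi.single z j : Bits n → ℕ) x).factorial : ℝ) =
      i.factorial * j.factorial := by
    rw [Finset.prod_eq_mul y z hyz]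
    · simp [hyz, hyz.symm]
    · intro x _ hx; simp [hx.1, hx.2]
    · simp
    · simp
  have h3 : ∑ x, (Pi.single y i + Pi.single z j : Bits n → ℕ) x = i + j := by
    simp [Finset.sum_add_distrib]
  rw [h2, h3] at h
  simpa only [h1] using h

/-- The quotient of factorials is `N(N+1)⋯(N+j-1) ≥ N^j`. This crude bound serves the subtracted
terms; the average of `Q_3` and the standalone average of `Q_2` enter positively and are computed
exactly. -/
theorem factorial_ratio_le (j : ℕ) (c : ℝ) (hc : 0 ≤ c) :
    (2 ^ n - 1).factorial * c / (2 ^ n - 1 + j).factorial ≤ c / (2 ^ n : ℝ) ^ j := by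
  have hN : 2 ^ n - 1 + 1 = 2 ^ n := Nat.sub_add_cancel Nat.one_le_two_pow
  have h := Nat.factorial_mul_pow_le_factorial (m := 2 ^ n - 1) (n := j)
  rw [hN] at h
  have h' : ((2 ^ n - 1).factorial : ℝ) * (2 ^ n : ℝ) ^ j ≤ (2 ^ n - 1 + j).factorial := by
    exact_mod_cast h
  rw [div_le_div_iff₀ (by positivity) (by positivity)]
  nlinarith

theorem integral_haarState_pow_mul_pow_le (y z : Bits n) (i j : ℕ) :
    ∫ ψ, (‖ψ.1 y‖ ^ 2) ^ i * (‖ψ.1 z‖ ^ 2) ^ j ∂haarState n ≤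
      (i.factorial * j.factorial + if y = z then ((i + j).factorial : ℝ) else 0) /
        (2 ^ n : ℝ) ^ (i + j) := by
  by_cases h : y = z
  · subst h
    simp only [← pow_add, if_true]
    rw [integral_haarState_pow]
    refine (factorial_ratio_le _ _ (by positivity)).trans ?_
    gcongr
    exact le_add_of_nonneg_left (by positivity)
  · rw [integral_haarState_pow_mul_pow h, if_neg h, add_zero]
    exact factorial_ratio_le _ _ (by positivity)

theorem continuous_norm_sq_state (z : Bits n) : Continuous fun ψ : State n => ‖ψ.1 z‖ ^ 2 := by
  fun_prop

theorem integral_haarState_powerSum (j : ℕ) :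
    ∫ ψ, ∑ z, (‖ψ.1 z‖ ^ 2) ^ j ∂haarState n =
      2 ^ n * ((2 ^ n - 1).factorial * j.factorial / (2 ^ n - 1 + j).factorial) := by
  have hI : ∀ z : Bits n, Integrable (fun ψ : State n => (‖ψ.1 z‖ ^ 2) ^ j) (haarState n) :=
    fun z => integrable_haarState_of_continuous ((continuous_norm_sq_state z).pow j)
  rw [integral_finsetSum _ fun z _ => hI z]
  simp [integral_haarState_pow]

theorem integral_haarState_powerSum_mul_le (i j : ℕ) :
    ∫ ψ, (∑ z, (‖ψ.1 z‖ ^ 2) ^ i) * ∑ z, (‖ψ.1 z‖ ^ 2) ^ j ∂haarState n ≤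
      ((2 ^ n) ^ 2 * (i.factorial * j.factorial) + 2 ^ n * ((i + j).factorial : ℝ)) /
        (2 ^ n : ℝ) ^ (i + j) := by
  have hI : ∀ y z : Bits n, Integrable
      (fun ψ : State n => (‖ψ.1 y‖ ^ 2) ^ i * (‖ψ.1 z‖ ^ 2) ^ j) (haarState n) := fun y z =>
    integrable_haarState_of_continuous
      (((continuous_norm_sq_state y).pow i).mul ((continuous_norm_sq_state z).pow j))
  simp only [Finset.sum_mul_sum]
  rw [integral_finsetSum _ fun y _ => integrable_finsetSum _ fun z _ => hI y z]
  simp only [integral_finsetSum _ fun z _ => hI _ z]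
  refine (Finset.sum_le_sum fun y _ => Finset.sum_le_sum fun z _ =>
    integral_haarState_pow_mul_pow_le y z i j).trans (le_of_eq ?_)
  simp only [← Finset.sum_div, Finset.sum_add_distrib, Finset.sum_const, Finset.card_univ,
    Finset.sum_ite_eq, Finset.mem_univ, if_true, nsmul_eq_mul]
  simp
  ring

theorem factorial_pred_two_pow (j : ℕ) :
    ((2 ^ n - 1 + (j + 1)).factorial : ℝ) = (2 ^ n + j) * (2 ^ n - 1 + j).factorial := by
  have hN : 2 ^ n - 1 + (j + 1) = 2 ^ n - 1 + j + 1 := rfl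
  have h1 : (2 ^ n - 1 + j + 1 : ℕ) = 2 ^ n + j := by have := Nat.one_le_two_pow (n := n); omega
  rw [hN, Nat.factorial_succ, h1]
  push_cast
  rfl

theorem integral_haarState_powerSum_two :
    ∫ ψ, ∑ z, (‖ψ.1 z‖ ^ 2) ^ 2 ∂haarState n = 2 / (2 ^ n + 1) := by
  rw [integral_haarState_powerSum, factorial_pred_two_pow, factorial_pred_two_pow]
  have : ((2 ^ n - 1).factorial : ℝ) ≠ 0 := by positivity
  simp only [Nat.factorial, add_zero]
  push_cast
  field_simp
  simp

theorem integral_haarState_powerSum_three :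
    ∫ ψ, ∑ z, (‖ψ.1 z‖ ^ 2) ^ 3 ∂haarState n = 6 / ((2 ^ n + 1) * (2 ^ n + 2)) := by
  rw [integral_haarState_powerSum, factorial_pred_two_pow, factorial_pred_two_pow,
    factorial_pred_two_pow]
  have : ((2 ^ n - 1).factorial : ℝ) ≠ 0 := by positivity
  simp only [Nat.factorial, add_zero]
  push_cast
  field_simp
  norm_num

theorem integral_haarState_powerSum_four_le :
    ∫ ψ, ∑ z, (‖ψ.1 z‖ ^ 2) ^ 4 ∂haarState n ≤ 24 / (2 ^ n) ^ 3 := by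
  rw [integral_haarState_powerSum]
  refine (mul_le_mul_of_nonneg_left (factorial_ratio_le 4 _ (by positivity))
    (by positivity)).trans (le_of_eq ?_)
  simp only [Nat.factorial]
  push_cast
  field_simp

/-- The pointwise bound is integrated. The constants `12 = 2!·3!`, `120 = 5!`, `4 = 2!·2!` and `24 =
4!` are the off-diagonal and diagonal parts of the averages of `Q_2 Q_3` and `Q_2²`. -/
theorem integral_haarState_expectInsert_ge (T k : ℕ) :
    ((2 * T + 1 : ℝ) ^ 2 - 1) *
        (k * (6 / ((2 ^ n + 1) * (2 ^ n + 2))) - k ^ 2 * (24 / (2 ^ n) ^ 3)) -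
        (2 * T + 1 : ℝ) ^ 4 / 3 *
          (k * (24 / (2 ^ n) ^ 3) +
            k ^ 2 * (((2 ^ n) ^ 2 * 12 + 2 ^ n * 120) / (2 ^ n) ^ 5)) -
        (2 * T + 1 : ℝ) ^ 2 * k * (((2 ^ n) ^ 2 * 4 + 2 ^ n * 24) / (2 ^ n) ^ 4) +
        2 / (2 ^ n + 1) ≤
      ∫ ψ, expectInsert (fun z => ‖ψ.1 z‖ ^ 2)
        (groverScore (fun z => ‖ψ.1 z‖ ^ 2) (fun z => ‖ψ.1 z‖ ^ 2) T) k ∅ ∂haarState n := by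
  have hp : Continuous fun (ψ : State n) (z : Bits n) => ‖ψ.1 z‖ ^ 2 :=
    continuous_pi fun z => continuous_norm_sq_state z
  have hF := integrable_haarState_of_continuous
    ((continuous_expectInsert_groverScore T k ∅).comp hp)
  have hQ : ∀ j, Continuous fun ψ : State n => ∑ z, (‖ψ.1 z‖ ^ 2) ^ j := fun j =>
    continuous_finsetSum _ fun z _ => (continuous_norm_sq_state z).pow j
  have i2 := integrable_haarState_of_continuous (hQ 2)
  have i3 := integrable_haarState_of_continuous (hQ 3)
  have i4 := integrable_haarState_of_continuous (hQ 4)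
  have i23 : Integrable (fun ψ : State n => (∑ z, (‖ψ.1 z‖ ^ 2) ^ 2) * ∑ z, (‖ψ.1 z‖ ^ 2) ^ 3)
      (haarState n) := integrable_haarState_of_continuous ((hQ 2).mul (hQ 3))
  have i22 : Integrable (fun ψ : State n => (∑ z, (‖ψ.1 z‖ ^ 2) ^ 2) ^ 2)
      (haarState n) := integrable_haarState_of_continuous ((hQ 2).pow 2)
  have iA := ((i3.const_mul (k : ℝ)).sub (i4.const_mul ((k : ℝ) ^ 2))).const_mul
    ((2 * T + 1 : ℝ) ^ 2 - 1)
  have iB := ((i4.const_mul (k : ℝ)).add (i23.const_mul ((k : ℝ) ^ 2))).const_mul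
    ((2 * T + 1 : ℝ) ^ 4 / 3)
  have iC := i22.const_mul ((2 * T + 1 : ℝ) ^ 2 * k)
  have h := integral_mono (((iA.sub iB).sub iC).add i2) hF fun ψ =>
    expectInsert_groverScore_ge (p := fun z => ‖ψ.1 z‖ ^ 2) (fun z => sq_nonneg _)
      (sum_norm_sq_state ψ) T k
  refine le_trans ?_ h
  rw [integral_add' ((iA.sub iB).sub iC) i2, integral_sub' (iA.sub iB) iC, integral_sub' iA iB]
  simp only [Pi.sub_apply, Pi.add_apply]
  rw [integral_const_mul, integral_const_mul, integral_const_mul,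
    integral_sub (i3.const_mul _) (i4.const_mul _), integral_add (i4.const_mul _) (i23.const_mul _)]
  simp only [integral_const_mul]
  rw [integral_haarState_powerSum_two, integral_haarState_powerSum_three]
  have e4 := integral_haarState_powerSum_four_le (n := n)
  have e22 := integral_haarState_powerSum_mul_le (n := n) 2 2
  have e23 := integral_haarState_powerSum_mul_le (n := n) 2 3
  simp only [← sq] at e22
  norm_num [Nat.factorial] at e22 e23
  have hT := Nat.cast_nonneg (α := ℝ) T
  have hm : (0 : ℝ) ≤ (2 * T + 1) ^ 2 - 1 := by nlinarith
  gcongr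

end PowerSums

/-! ### Choice of parameters and numerical estimates. -/

section Parameters

/-- Here `q` is both the sample and the step count. To leading order the gain is `24q³/N²`, against
losses `16q³/N²` (probability taken from the bad part) and `64q⁶/N³` (curvature of the
amplification). At `q³ ≈ N/64` the net gain is `(1/8 - 1/64)/N`, which leaves slack above `1/50`. -/
theorem score_bound_numeric {q N : ℝ} (hq : 50 ≤ q) (h1 : 64 * q ^ 3 ≤ N)
    (h2 : N ≤ 64 * (q + 1) ^ 3) :
    (2 + 1 / 50) / N ≤
      ((2 * q + 1) ^ 2 - 1) * (q * (6 / ((N + 1) * (N + 2))) - q ^ 2 * (24 / N ^ 3)) -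
        (2 * q + 1) ^ 4 / 3 * (q * (24 / N ^ 3) + q ^ 2 * ((N ^ 2 * 12 + N * 120) / N ^ 5)) -
        (2 * q + 1) ^ 2 * q * ((N ^ 2 * 4 + N * 24) / N ^ 4) + 2 / (N + 1) := by
  have hq0 : 0 < q := by linarith
  have hm2 : (2 * q + 1) ^ 2 ≤ 4.09 * q ^ 2 := by nlinarith
  have hm4 : (2 * q + 1) ^ 4 ≤ 16.8 * q ^ 4 := by
    have := mul_self_le_mul_self (by positivity) hm2
    nlinarith [pow_pos hq0 4]
  have hq3 : 2500 * q ≤ q ^ 3 := by nlinarith [mul_self_le_mul_self (by norm_num) hq]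
  have hN8 : 1000000 ≤ N := by nlinarith
  have hN0 : 0 < N := by linarith
  have h3 : N ≤ 68 * q ^ 3 := by
    have hle : q + 1 ≤ 1.02 * q := by linarith
    have := pow_le_pow_left₀ (by linarith) hle 3
    nlinarith [pow_pos hq0 3]
  have a1 : 0.34 / N ≤ ((2 * q + 1) ^ 2 - 1) * (q * (6 / ((N + 1) * (N + 2)))) := by
    have : 24 * q ^ 3 / ((N + 1) * (N + 2)) ≤
        ((2 * q + 1) ^ 2 - 1) * (q * (6 / ((N + 1) * (N + 2)))) := by
      rw [mul_div_assoc', mul_div_assoc']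
      refine div_le_div_of_nonneg_right ?_ (by positivity)
      nlinarith [pow_pos hq0 2]
    refine le_trans ?_ this
    rw [div_le_div_iff₀ hN0 (by positivity)]
    nlinarith
  have q6 : q ^ 6 ≤ N ^ 2 / 4096 := by
    have := mul_self_le_mul_self (by positivity) h1
    nlinarith
  have q5 : q ^ 5 ≤ N ^ 2 / 4096 / 50 := by
    have : 50 * q ^ 5 ≤ q * q ^ 5 := by gcongr
    nlinarith
  have q4 : q ^ 4 ≤ N ^ 2 / 4096 / 2500 := by
    have : 50 * q ^ 4 ≤ q * q ^ 4 := by gcongr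
    nlinarith
  have a2 : ((2 * q + 1) ^ 2 - 1) * (q ^ 2 * (24 / N ^ 3)) ≤ 0.001 / N := by
    calc _ ≤ 4.09 * q ^ 2 * (q ^ 2 * (24 / N ^ 3)) := by gcongr; linarith
      _ = 4.09 * 24 * q ^ 4 / N ^ 3 := by ring
      _ ≤ _ := by
        rw [div_le_div_iff₀ (by positivity) hN0]
        nlinarith [mul_le_mul_of_nonneg_right q4 hN0.le, pow_pos hN0 3]
  have a3 : (2 * q + 1) ^ 4 / 3 * (q * (24 / N ^ 3)) ≤ 0.001 / N := by
    calc _ ≤ 16.8 * q ^ 4 / 3 * (q * (24 / N ^ 3)) := by gcongr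
      _ = 16.8 * 8 * q ^ 5 / N ^ 3 := by ring
      _ ≤ _ := by
        rw [div_le_div_iff₀ (by positivity) hN0]
        nlinarith [mul_le_mul_of_nonneg_right q5 hN0.le, pow_pos hN0 3]
  have a4 : (2 * q + 1) ^ 4 / 3 * (q ^ 2 * ((N ^ 2 * 12 + N * 120) / N ^ 5)) ≤ 0.02 / N := by
    calc _ ≤ 16.8 * q ^ 4 / 3 * (q ^ 2 * ((N ^ 2 * 12 + N * (0.001 * N)) / N ^ 5)) := by
          gcongr; linarith
      _ = 16.8 / 3 * 12.001 * q ^ 6 / N ^ 3 := by field_simp; ring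
      _ ≤ _ := by
        rw [div_le_div_iff₀ (by positivity) hN0]
        nlinarith [mul_le_mul_of_nonneg_right q6 hN0.le, pow_pos hN0 3]
  have a5 : (2 * q + 1) ^ 2 * q * ((N ^ 2 * 4 + N * 24) / N ^ 4) ≤ 0.26 / N := by
    calc _ ≤ 4.09 * q ^ 2 * q * ((N ^ 2 * 4 + N * (0.001 * N)) / N ^ 4) := by gcongr; linarith
      _ = 4.09 * 4.001 * q ^ 3 / N ^ 2 := by field_simp; ring
      _ ≤ _ := by
        rw [div_le_div_iff₀ (by positivity) hN0]
        nlinarith [mul_le_mul_of_nonneg_right h1 hN0.le, pow_pos hN0 2]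
  have a6 : (2 - 0.001) / N ≤ 2 / (N + 1) := by
    rw [div_le_div_iff₀ hN0 (by linarith)]
    linarith
  have key : (2 + 1 / 50) / N ≤
      0.34 / N - 0.001 / N - (0.001 / N + 0.02 / N) - 0.26 / N + (2 - 0.001) / N := by
    rw [← sub_div, ← add_div, ← sub_div, ← sub_div, ← add_div]
    refine div_le_div_of_nonneg_right ?_ hN0.le
    norm_num
  rw [mul_sub ((2 * q + 1) ^ 2 - 1), mul_add ((2 * q + 1) ^ 4 / 3)]
  linarith

/-- The number of samples and of amplification steps of the algorithm. -/
noncomputable def stepCount (n : ℕ) : ℕ := ⌊(2 : ℝ) ^ ((n : ℝ) / 3) / 4⌋₊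

theorem two_rpow_third_pow (n : ℕ) : ((2 : ℝ) ^ ((n : ℝ) / 3)) ^ 3 = 2 ^ n := by
  rw [← Real.rpow_natCast, ← Real.rpow_mul (by norm_num), ← Real.rpow_natCast]
  congr 1
  push_cast
  ring

theorem stepCount_le (n : ℕ) : (stepCount n : ℝ) ≤ (2 : ℝ) ^ ((n : ℝ) / 3) / 4 :=
  Nat.floor_le (by positivity)

theorem queries_le (n : ℕ) :
    ((stepCount n + 1 + 2 * stepCount n : ℕ) : ℝ) ≤ 2 * (2 : ℝ) ^ ((n : ℝ) / 3) := by
  have h := stepCount_le n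
  have h1 : (1 : ℝ) ≤ (2 : ℝ) ^ ((n : ℝ) / 3) := Real.one_le_rpow (by norm_num) (by positivity)
  push_cast
  linarith

theorem two_add_div_le_integral {n : ℕ} (hn : 24 ≤ n) :
    (2 + 1 / 50 : ℝ) / 2 ^ n ≤
      ∫ ψ, expectInsert (fun z => ‖ψ.1 z‖ ^ 2)
        (groverScore (fun z => ‖ψ.1 z‖ ^ 2) (fun z => ‖ψ.1 z‖ ^ 2) (stepCount n))
        (stepCount n) ∅ ∂haarState n := by
  refine le_trans ?_ (integral_haarState_expectInsert_ge (stepCount n) (stepCount n))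
  have h3 := two_rpow_third_pow n
  have hlt : (2 : ℝ) ^ ((n : ℝ) / 3) / 4 < stepCount n + 1 := Nat.lt_floor_add_one _
  have hle := stepCount_le n
  -- The threshold `n ≥ 24` gives `2^{n/3} ≥ 2^8`, hence a step count above `63`.
  have h8 : (256 : ℝ) ≤ (2 : ℝ) ^ ((n : ℝ) / 3) := by
    have : (2 : ℝ) ^ (8 : ℝ) ≤ (2 : ℝ) ^ ((n : ℝ) / 3) := by
      apply Real.rpow_le_rpow_of_exponent_le (by norm_num)
      have : (24 : ℝ) ≤ n := by exact_mod_cast hn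
      linarith
    refine le_trans ?_ this
    norm_num
  set y := (2 : ℝ) ^ ((n : ℝ) / 3)
  have hq0 := Nat.cast_nonneg (α := ℝ) (stepCount n)
  apply score_bound_numeric
  · linarith
  · rw [← h3]
    have := pow_le_pow_left₀ hq0 hle 3
    nlinarith
  · rw [← h3]
    have := pow_le_pow_left₀ (by positivity) hlt.le 3
    nlinarith

end Parameters

/-! ### Unitary invariance, and columns of Haar unitaries. -/

section UnitaryAction

variable {n : ℕ}

theorem norm_toLp_unitary_mulVec (V : unitaryGroup (Bits n) ℂ) (v : EuclideanSpace ℂ (Bits n)) :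
    ‖WithLp.toLp 2 ((V : Matrix (Bits n) (Bits n) ℂ) *ᵥ v.ofLp)‖ = ‖v‖ := by
  have h : ∀ w : Bits n → ℂ, ((∑ i, ‖w i‖ ^ 2 : ℝ) : ℂ) = star w ⬝ᵥ w := by
    intro w
    simp [dotProduct, Complex.conj_mul']
  have hV : (V : Matrix (Bits n) (Bits n) ℂ)ᴴ * (V : Matrix (Bits n) (Bits n) ℂ) = 1 :=
    mem_unitaryGroup_iff'.1 V.2
  rw [← sq_eq_sq₀ (norm_nonneg _) (norm_nonneg _), EuclideanSpace.norm_sq_eq,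
    EuclideanSpace.norm_sq_eq]
  apply Complex.ofReal_injective
  rw [h v.ofLp]
  refine (h _).trans ?_
  rw [star_mulVec, dotProduct_mulVec, vecMul_vecMul, hV, vecMul_one]

/-- A unitary matrix as a linear isometry of the Euclidean space. -/
noncomputable def unitaryIsometry (V : unitaryGroup (Bits n) ℂ) :
    EuclideanSpace ℂ (Bits n) ≃ₗᵢ[ℂ] EuclideanSpace ℂ (Bits n) where
  toFun v := WithLp.toLp 2 ((V : Matrix (Bits n) (Bits n) ℂ) *ᵥ v.ofLp)
  invFun v := WithLp.toLp 2 (((V⁻¹ : unitaryGroup (Bits n) ℂ) : Matrix (Bits n) (Bits n) ℂ) *ᵥ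
    v.ofLp)
  map_add' v w := by simp [mulVec_add]
  map_smul' c v := by simp [mulVec_smul]
  left_inv v := by
    refine congrArg (WithLp.toLp 2) ?_
    rw [mulVec_mulVec, ← Submonoid.coe_mul, inv_mul_cancel]
    exact one_mulVec _
  right_inv v := by
    refine congrArg (WithLp.toLp 2) ?_
    rw [mulVec_mulVec, ← Submonoid.coe_mul, mul_inv_cancel]
    exact one_mulVec _
  norm_map' v := norm_toLp_unitary_mulVec V v

/-- The action of a unitary matrix on states. -/
noncomputable def unitaryAct (V : unitaryGroup (Bits n) ℂ) (ψ : State n) : State n :=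
  ⟨unitaryIsometry V ψ.1, by simp⟩

theorem unitaryAct_mul (V W : unitaryGroup (Bits n) ℂ) (ψ : State n) :
    unitaryAct (V * W) ψ = unitaryAct V (unitaryAct W ψ) := by
  refine Subtype.ext (congrArg (WithLp.toLp 2) ?_)
  exact (mulVec_mulVec _ _ _).symm

theorem unitaryAct_one (ψ : State n) : unitaryAct 1 ψ = ψ := by
  refine Subtype.ext (congrArg (WithLp.toLp 2) ?_)
  exact one_mulVec _

theorem continuous_unitaryAct :
    Continuous fun q : unitaryGroup (Bits n) ℂ × State n => unitaryAct q.1 q.2 := by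
  refine Continuous.subtype_mk ((PiLp.continuous_toLp 2 _).comp ?_) _
  refine Continuous.matrix_mulVec (by fun_prop) ?_
  exact (PiLp.continuous_ofLp 2 _).comp (by fun_prop)

/-- By uniqueness of Haar measure the image is a multiple of the original, and the preserved unit
ball forces the factor to be `1`. -/
theorem map_unitaryIsometry_addHaar (V : unitaryGroup (Bits n) ℂ) :
    Measure.map (unitaryIsometry V) (Measure.addHaar : Measure (EuclideanSpace ℂ (Bits n))) =
      Measure.addHaar := by
  set μ : Measure (EuclideanSpace ℂ (Bits n)) := Measure.addHaar
  have hmap : (Measure.map (unitaryIsometry V) μ).IsAddHaarMeasure :=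
    (unitaryIsometry V).toContinuousLinearEquiv.isAddHaarMeasure_map μ
  have h := Measure.isAddLeftInvariant_eq_smul (Measure.map (unitaryIsometry V) μ) μ
  have hb : Measure.map (unitaryIsometry V) μ (Metric.ball 0 1) = μ (Metric.ball 0 1) := by
    rw [Measure.map_apply (unitaryIsometry V).continuous.measurable measurableSet_ball]
    congr 1
    ext x
    simp
  set c := Measure.addHaarScalarFactor (Measure.map (unitaryIsometry V) μ) μ
  rw [h, Measure.smul_apply, ENNReal.smul_def, smul_eq_mul] at hb
  have hc : (c : ENNReal) = 1 := by
    refine (ENNReal.mul_left_inj (Metric.measure_ball_pos μ 0 one_pos).ne'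
      (measure_ball_lt_top (μ := μ)).ne).1 ?_
    rw [hb, one_mul]
  rw [h, show c = 1 by exact_mod_cast hc, one_smul]

/-- Surface measure is defined through the volume of cones over subsets of the sphere, and a linear
isometry maps cones to cones. -/
theorem map_unitaryAct_haarState (V : unitaryGroup (Bits n) ℂ) :
    Measure.map (unitaryAct V) (haarState n) = haarState n := by
  have hV : Measurable (unitaryAct V) :=
    (continuous_unitaryAct.comp (by fun_prop : Continuous fun ψ : State n => (V, ψ))).measurable
  rw [haarState, Measure.map_smul]
  congr 1
  ext s hs
  rw [Measure.map_apply hV hs, Measure.toSphere_apply' _ hs, Measure.toSphere_apply' _ (hV hs)]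
  congr 1
  have he : MeasurableEmbedding (unitaryIsometry V) :=
    (unitaryIsometry V).toHomeomorph.measurableEmbedding
  conv_rhs => rw [← map_unitaryIsometry_addHaar V, he.map_apply]
  congr 1
  ext x
  simp only [Set.mem_smul, Set.mem_image, Set.mem_preimage]
  constructor
  · rintro ⟨r, hr, _, ⟨ψ, hψ, rfl⟩, rfl⟩
    exact ⟨r, hr, _, ⟨_, hψ, rfl⟩, ((unitaryIsometry V).map_smul_of_tower r ψ.1).symm⟩
  · rintro ⟨r, hr, _, ⟨ψ, hψ, rfl⟩, hx⟩
    refine ⟨r, hr, _, ⟨unitaryAct V⁻¹ ψ, ?_, rfl⟩, ?_⟩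
    · rwa [← unitaryAct_mul, mul_inv_cancel, unitaryAct_one]
    · apply (unitaryIsometry V).injective
      refine Eq.trans ?_ hx
      have : unitaryIsometry V (unitaryAct V⁻¹ ψ).1 = ψ.1 := by
        change (unitaryAct V (unitaryAct V⁻¹ ψ)).1 = ψ.1
        rw [← unitaryAct_mul, mul_inv_cancel, unitaryAct_one]
      rw [← this]
      exact (unitaryIsometry V).map_smul_of_tower r _

/-- The basis state of the string `b`. -/
noncomputable def basisState (b : Bits n) : State n :=
  ⟨EuclideanSpace.single b 1, by simp⟩

theorem unitaryAct_basisState_apply (V : unitaryGroup (Bits n) ℂ) (b z : Bits n) :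
    (unitaryAct V (basisState b)).1 z = V z b := by
  change ((V : Matrix (Bits n) (Bits n) ℂ) *ᵥ (Pi.single b 1)) z = V z b
  simp

/-- Transitivity: `ψ` is extended to an orthonormal basis that has it at index `b`, and the basis
vectors are the columns of `W`. -/
theorem exists_unitaryAct_basisState_eq (b : Bits n) (ψ : State n) :
    ∃ W, unitaryAct W (basisState b) = ψ := by
  have hψ : Orthonormal ℂ (({b} : Set (Bits n)).domRestrict fun _ => ψ.1) := by
    refine ⟨fun i => norm_eq_of_mem_sphere ψ, fun i j hij => absurd (Subsingleton.elim i j) hij⟩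
  obtain ⟨e, he⟩ := hψ.exists_orthonormalBasis_extension_of_card_eq (by simp)
  refine ⟨⟨(EuclideanSpace.basisFun (Bits n) ℂ).toBasis.toMatrix e,
    (EuclideanSpace.basisFun (Bits n) ℂ).toMatrix_orthonormalBasis_mem_unitary e⟩, ?_⟩
  refine Subtype.ext (PiLp.ext fun z => ?_)
  rw [unitaryAct_basisState_apply, ← he b rfl]
  simp [Module.Basis.toMatrix_apply]

instance secondCountableTopology_unitaryGroup :
    SecondCountableTopology (unitaryGroup (Bits n) ℂ) :=
  have : SecondCountableTopology (Matrix (Bits n) (Bits n) ℂ) :=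
    inferInstanceAs (SecondCountableTopology (Bits n → Bits n → ℂ))
  TopologicalSpace.Subtype.secondCountableTopology _

/-- Integrals against a unitarily invariant probability measure on the states can be computed with
a left invariant probability measure on the unitary group. -/
theorem integral_eq_integral_unitaryAct_inv (ν : Measure (unitaryGroup (Bits n) ℂ))
    [IsProbabilityMeasure ν] [ν.IsMulLeftInvariant] (τ : Measure (State n))
    [IsProbabilityMeasure τ] (hτ : ∀ V, Measure.map (unitaryAct V) τ = τ) {f : State n → ℝ}
    (hf : Continuous f) (b : Bits n) :
    ∫ ψ, f ψ ∂τ = ∫ V, f (unitaryAct V⁻¹ (basisState b)) ∂ν := by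
  have hinv : Continuous fun V : unitaryGroup (Bits n) ℂ => V⁻¹ := continuous_inv
  have hc : Continuous fun q : unitaryGroup (Bits n) ℂ × State n => f (unitaryAct q.1⁻¹ q.2) := by
    have h := (hf.comp continuous_unitaryAct).comp
      ((hinv.comp continuous_fst).prodMk continuous_snd)
    simpa only [Function.comp_def] using h
  obtain ⟨C, hC⟩ := isCompact_univ.exists_bound_of_continuousOn (hf.continuousOn (s := Set.univ))
  have hI : Integrable (fun q : unitaryGroup (Bits n) ℂ × State n => f (unitaryAct q.1⁻¹ q.2))
      (ν.prod τ) :=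
    Integrable.of_bound hc.aestronglyMeasurable C
      (Filter.Eventually.of_forall fun q => hC _ (Set.mem_univ _))
  have hact : ∀ V : unitaryGroup (Bits n) ℂ, Measurable (unitaryAct V) := fun V =>
    (continuous_unitaryAct.comp (by fun_prop : Continuous fun ψ : State n => (V, ψ))).measurable
  calc ∫ ψ, f ψ ∂τ = ∫ V, ∫ ψ, f (unitaryAct V⁻¹ ψ) ∂τ ∂ν := by
        have : ∀ V : unitaryGroup (Bits n) ℂ, ∫ ψ, f (unitaryAct V⁻¹ ψ) ∂τ = ∫ ψ, f ψ ∂τ := by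
          intro V
          rw [← integral_map (hact V⁻¹).aemeasurable (hf.aestronglyMeasurable), hτ]
        simp [this]
    _ = ∫ ψ, ∫ V, f (unitaryAct V⁻¹ ψ) ∂ν ∂τ := integral_integral_swap hI
    _ = ∫ _ψ, ∫ V, f (unitaryAct V⁻¹ (basisState b)) ∂ν ∂τ := by
        refine integral_congr_ae (Filter.Eventually.of_forall fun ψ => ?_)
        obtain ⟨W, rfl⟩ := exists_unitaryAct_basisState_eq b ψ
        simp only
        -- The substitution `V ↦ W V` turns `V⁻¹ W` into `V⁻¹ W⁻¹ W = V⁻¹`. The inverse in the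
        -- formula is what lets left invariance absorb `W`.
        rw [← integral_mul_left_eq_self _ W]
        refine integral_congr_ae (Filter.Eventually.of_forall fun V => ?_)
        simp only
        rw [← unitaryAct_mul, _root_.mul_inv_rev, inv_mul_cancel_right]
    _ = _ := by simp

/-- A column of a Haar-random unitary is a Haar-random state. -/
theorem integral_column_eq_integral_haarState (ν : Measure (unitaryGroup (Bits n) ℂ))
    [IsProbabilityMeasure ν] [ν.IsMulLeftInvariant] {f : State n → ℝ} (hf : Continuous f)
    (b : Bits n) :
    ∫ U, f (unitaryAct U (basisState b)) ∂ν = ∫ ψ, f ψ ∂haarState n := by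
  have hcol : Measurable fun U : unitaryGroup (Bits n) ℂ => unitaryAct U (basisState b) :=
    (continuous_unitaryAct.comp
      (by fun_prop : Continuous fun U => (U, basisState b))).measurable
  have hact : ∀ V : unitaryGroup (Bits n) ℂ, Measurable (unitaryAct V) := fun V =>
    (continuous_unitaryAct.comp (by fun_prop : Continuous fun ψ : State n => (V, ψ))).measurable
  have := Measure.isProbabilityMeasure_map (μ := ν) hcol.aemeasurable
  rw [← integral_map hcol.aemeasurable hf.aestronglyMeasurable,
    integral_eq_integral_unitaryAct_inv ν (haarState n) map_unitaryAct_haarState hf b]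
  -- The law of the column is also unitarily invariant, so the same group integral computes both
  -- sides; neither right nor inversion invariance of `ν` is needed.
  refine integral_eq_integral_unitaryAct_inv ν _ (fun V => ?_) hf b
  rw [Measure.map_map (hact V) hcol]
  conv_rhs => rw [← map_mul_left_eq_self ν V, Measure.map_map hcol (measurable_const_mul V)]
  congr 1
  ext1 U
  exact (unitaryAct_mul V U _).symm

end UnitaryAction

/-! ### The three oracle models. -/

section Oracles

variable {n : ℕ}

/-- The expected score of the collision finder on an oracle that prepares `ψ`. -/
noncomputable def collisionScore (n : ℕ) (ψ : State n) : ℝ :=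
  expectInsert (fun z => ‖ψ.1 z‖ ^ 2)
    (groverScore (fun z => ‖ψ.1 z‖ ^ 2) (fun z => ‖ψ.1 z‖ ^ 2) (stepCount n)) (stepCount n) ∅

theorem continuous_collisionScore : Continuous (collisionScore n) :=
  (continuous_expectInsert_groverScore (stepCount n) (stepCount n) ∅).comp
    (continuous_pi fun z => continuous_norm_sq_state z)

/-- Only the first register is read, and the garbage factor has norm `1`, so its state `φ`
disappears from the outcome law. -/
theorem score_of_prepares {G : Type} [Fintype G] [DecidableEq G] {g₀ : G}
    {U : unitaryGroup (Bits n × G) ℂ} {ψ : State n} (h : Prepares g₀ U ψ) :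
    (collisionFinder Prod.fst (zeros n, g₀) (stepCount n) (stepCount n) ∅).score
      (zeros n, g₀) U ψ.1 = collisionScore n ψ := by
  obtain ⟨φ, hφ⟩ := h
  refine score_collisionFinder _ _ _ _ _ _ fun z => ?_
  have h1 : ∑ g, ‖φ.1 g‖ ^ 2 = 1 := by
    rw [← EuclideanSpace.norm_sq_eq, norm_eq_of_mem_sphere φ, one_pow]
  rw [outcomeLaw, Finset.sum_filter, Fintype.sum_prod_type]
  simp only [hφ, norm_mul, mul_pow]
  rw [Finset.sum_eq_single z]
  · simp [← Finset.mul_sum, h1]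
  · intro y _ hy; simp [hy]
  · simp

/-- The reflection about the normalized difference of the orthonormal vectors `|ψ⟩|1⟩` and `|⊥⟩`
exchanges them. The flag qubit thus plays the garbage, starting in `|0⟩` and ending in `|1⟩`. -/
theorem prepares_canonicalOracle (ψ : State n) : Prepares false (canonicalOracle ψ) ψ := by
  refine ⟨⟨EuclideanSpace.single true 1, by simp⟩, fun x g => ?_⟩
  have h2 : ((Real.sqrt 2 : ℝ) : ℂ) * ((Real.sqrt 2 : ℝ) : ℂ) = 2 := by
    rw [← Complex.ofReal_mul, Real.mul_self_sqrt (by norm_num)]; norm_num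
  change (1 - (2 : ℂ) • vecMulVec (canonicalVector ψ) (star (canonicalVector ψ)))
    (x, g) (zeros n, false) = _
  have hbot : star (canonicalVector ψ) (zeros n, false) = -1 / (Real.sqrt 2 : ℂ) := by
    simp [canonicalVector]
  rw [Matrix.sub_apply, Matrix.smul_apply, vecMulVec_apply, hbot, canonicalVector, one_apply,
    div_mul_div_comm, h2]
  cases g
  · by_cases hx : x = zeros n <;> simp [hx]
  · simp
    ring

theorem score_column (U : unitaryGroup (Bits n) ℂ) :
    (collisionFinder id (zeros n) (stepCount n) (stepCount n) ∅).score
      (zeros n) U (fun x => U x (zeros n)) =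
        collisionScore n (unitaryAct U (basisState (zeros n))) := by
  rw [score_collisionFinder, collisionScore]
  · simp only [unitaryAct_basisState_apply]
  · intro z
    rw [outcomeLaw, Finset.sum_filter]
    simp

end Oracles

end XHOG

open MeasureTheory in
theorem theorem3p5 :
    ∃ ε : ℝ, 0 < ε ∧ ∃ C : ℝ, 0 < C ∧ ∃ n₀ : ℕ, ∀ n : ℕ, n₀ ≤ n →
      -- every oracle that prepares a Haar-random state, possibly with unentangled garbage
      (∀ (G : Type) [Fintype G] [DecidableEq G] (g₀ : G),
        ∃ (a : ℕ) (A : XHOG.QueryAlgorithm n (XHOG.Bits n × G) a),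
          (A.queries : ℝ) ≤ C * (2 : ℝ) ^ ((n : ℝ) / 3) ∧
          ∀ μ : Measure (XHOG.State n × Matrix.unitaryGroup (XHOG.Bits n × G) ℂ),
            XHOG.IsHaarPreparationLaw g₀ μ →
              (2 + ε) / 2 ^ n ≤ ∫ p, A.score (XHOG.zeros n, g₀) p.2 p.1.1 ∂μ) ∧
      -- the canonical state preparation oracle
      (∃ (a : ℕ) (A : XHOG.QueryAlgorithm n (XHOG.Bits n × Bool) a),
          (A.queries : ℝ) ≤ C * (2 : ℝ) ^ ((n : ℝ) / 3) ∧
          (2 + ε) / 2 ^ n ≤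
            ∫ ψ, A.score (XHOG.zeros n, false) (XHOG.canonicalOracle ψ) ψ.1
              ∂(XHOG.haarState n)) ∧
      -- a Haar-random unitary
      (∃ (a : ℕ) (A : XHOG.QueryAlgorithm n (XHOG.Bits n) a),
          (A.queries : ℝ) ≤ C * (2 : ℝ) ^ ((n : ℝ) / 3) ∧
          ∀ ν : Measure (Matrix.unitaryGroup (XHOG.Bits n) ℂ),
            IsProbabilityMeasure ν → ν.IsMulLeftInvariant →
              (2 + ε) / 2 ^ n ≤
                ∫ U, A.score (XHOG.zeros n) U (fun x => U x (XHOG.zeros n)) ∂ν) := by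
  refine ⟨1 / 50, by norm_num, 2, by norm_num, 24, fun n hn => ?_⟩
  have hscore : (2 + 1 / 50 : ℝ) / 2 ^ n ≤ ∫ ψ, XHOG.collisionScore n ψ ∂XHOG.haarState n :=
    XHOG.two_add_div_le_integral hn
  have hqueries : ∀ {m : ℕ}, m ≤ XHOG.stepCount n + 1 + 2 * XHOG.stepCount n →
      (m : ℝ) ≤ 2 * (2 : ℝ) ^ ((n : ℝ) / 3) := fun h =>
    (Nat.cast_le.2 h).trans (XHOG.queries_le n)
  refine ⟨fun G _ _ g₀ => ⟨0, _, hqueries (XHOG.queries_collisionFinder Prod.fst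
    (XHOG.zeros n, g₀) _ _ ∅), fun μ hμ => ?_⟩, ⟨0, _, hqueries (XHOG.queries_collisionFinder
    Prod.fst (XHOG.zeros n, false) _ _ ∅), ?_⟩, ⟨0, _, hqueries (XHOG.queries_collisionFinder id
    (XHOG.zeros n) _ _ ∅), fun ν hν hinv => ?_⟩⟩
  -- Almost surely the score is a function of `ψ` alone, so only the first marginal of `μ` matters.
  · rw [integral_congr_ae (hμ.prepares.mono fun p hp => XHOG.score_of_prepares hp),
      ← integral_map (φ := Prod.fst) (f := XHOG.collisionScore n) measurable_fst.aemeasurable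
        XHOG.continuous_collisionScore.aestronglyMeasurable, hμ.map_fst]
    exact hscore
  · simp only [XHOG.score_of_prepares (XHOG.prepares_canonicalOracle _)]
    exact hscore
  · simp only [XHOG.score_column]
    rw [XHOG.integral_column_eq_integral_haarState ν XHOG.continuous_collisionScore]
    exact hscore
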